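/- **Trees.** Batanin trees are the finite rooted planar trees $\mathrm{br}[B_1,\dots,B_m]$, defined inductively; $\dim B$ is the height of $B$, and $\partial_k B$ is obtained from $B$ by removing all nodes of height more than $k$. The globes are $D_0=\mathrm{br}[\,]$ and $D_{n+1}=\mathrm{br}[D_n]$. The globular set of positions $\mathrm{Pos}(B)$ (the pasting diagram of shape $B$) is defined inductively: every tree $B$ has a $0$-position $\mathrm{here}$; every $n$-position $p$ of $\mathrm{br}\,L$ gives an $n$-position $\mathrm{inr}\,p$ of $\mathrm{br}[B,L]$; every $n$-position $q$ of $B$ gives an $(n+1)$-position $\mathrm{inl}\,q$ of $\mathrm{br}[B,L]$. Source and target commute with $\mathrm{inr}$, and with $\mathrm{inl}$ on positions of positive dimension, while for a $0$-position $q$ the source of $\mathrm{inl}\,q$ is $\mathrm{here}$ and its target is $\mathrm{inr}(\mathrm{here})$. There are source and target inclusions $s_k^B,t_k^B:\mathrm{Pos}(\partial_kB)\to\mathrm{Pos}(B)$, defined recursively: for $B=\mathrm{br}[\,]$ both are the identity; on other trees $s_0(\mathrm{here})=\mathrm{here}$, $t_0^{\mathrm{br}[B,L]}(\mathrm{here})=\mathrm{inr}(t_0^{\mathrm{br}L}(\mathrm{here}))$,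 both $s_{k+1}$ and $t_{k+1}$ fix $\mathrm{here}$ and commute with $\mathrm{inr}$, and $s_{k+1}(\mathrm{inl}\,p)=\mathrm{inl}(s_k p)$, $t_{k+1}(\mathrm{inl}\,p)=\mathrm{inl}(t_k p)$. An $n$-position is *source boundary* (resp. *target boundary*) if it is not the target (resp. source) of any $(n+1)$-position; $\partial^s_n B$ and $\partial^t_n B$ denote the sets of source and target boundary $n$-positions. **Computads.** By recursion on $n$ one defines the category of $n$-computads, the sets $\mathrm{Cell}_n(C)$ and $\mathrm{Sph}_n(C)$ of $n$-cells and $n$-spheres of an $n$-computad $C$ (functorial in $C$), the $n$-computad $\mathrm{Free}_n X$ on a globular set $X$ (functorial in $X$), and the full $n$-spheres of a tree $B$, which are certain elements of $\mathrm{Sph}_n(\mathrm{Free}_n\mathrm{Pos}(B))$. A $0$-computad is a set $C$, its homomorphisms are functions, $\mathrm{Cell}_0(C)=C$, $\mathrm{Sph}_0(C)=C\times C$, $\mathrm{Free}_0X=X_0$, and a $0$-sphere $(a,b)$ of $B$ is full if $a\in\partial_0^sB$ and $b\in\partial_0^tB$. For $n\ge1$: * an $n$-computad $C=(C_{n-1},V_n^C,\phi_n^C)$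 is an $(n-1)$-computad $C_{n-1}$ with a set $V_n^C$ of generators and a function $\phi_n^C:V_n^C\to\mathrm{Sph}_{n-1}(C_{n-1})$; for $\mathrm{Free}_nX$ these are $\mathrm{Free}_{n-1}X$, $X_n$, and $x\mapsto$ the sphere of generators $(\mathrm{src}\,x,\mathrm{tgt}\,x)$; * the $n$-cells of $C$, with their boundary $\mathrm{ty}$ in $\mathrm{Sph}_{n-1}(C_{n-1})$, are generated inductively by the generators $v\in V_n^C$, with boundary $\phi_n^C(v)$, and the coherence cells $\mathrm{coh}(B,A,\tau)$, where $\dim B\le n$, $A$ is a full $(n-1)$-sphere of $B$ and $\tau:\mathrm{Free}_n\mathrm{Pos}(B)\to C$ is an $n$-homomorphism, with boundary $\tau_{n-1}(A)$; * an $n$-homomorphism $\tau:D\to C$ is an $(n-1)$-homomorphism $\tau_{n-1}:D_{n-1}\to C_{n-1}$ with a function $\tau_V:V_n^D\to\mathrm{Cell}_n(C)$ such that $\mathrm{ty}\circ\tau_V=\mathrm{Sph}_{n-1}(\tau_{n-1})\circ\phi^D_n$; it acts on cells by $v\mapsto\tau_V(v)$ and $\mathrm{coh}(B,A,\rho)\mapsto\mathrm{coh}(B,A,\tau\circ\rho)$;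 * an $n$-sphere $A=(A',a,b)$ of $C$ is an $(n-1)$-sphere $A'$ of $C_{n-1}$ with two $n$-cells $a=\mathrm{pr}_1A$, $b=\mathrm{pr}_2A$ of $C$ of boundary $A'$; * an $n$-sphere $(A',a,b)$ of $B$ is *full* if $A'$ is full, $\mathrm{supp}_n(a)=\partial_n^sB$ and $\mathrm{supp}_n(b)=\partial_n^tB$. Here, for $k\le n$, the $k$-dimensional support $\mathrm{supp}_k(c)\subseteq V^C_k$ of an $n$-cell $c$ is $\{c\}$ if $n=k=0$; for a generator $v$ of dimension $n\ge1$, $\mathrm{supp}_n(v)=\{v\}$ and $\mathrm{supp}_k(v)$, for $k<n$, is the union of the $k$-dimensional supports of its source and its target; and $\mathrm{supp}_k(\mathrm{coh}(B,A,\tau))$ is the union of the sets $\mathrm{supp}_k(\tau(p))$ over all positions $p$ of $B$; for $k>n$ it is empty. The $k$-dimensional support of a homomorphism $\sigma:D\to C$ is the union of those of the images of the generators of $D$ (of all dimensions), and $\sigma$ is a *cover* if its $k$-dimensional support is $V_k^C$ for every $k$. An $n$-cell $c$ of $C$ *covers* $C$ if the corresponding homomorphism from the free computad on the globe $D_n$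 to $C$, which sends the top generator to $c$, is a cover. A cell covers a tree $B$ if it covers the free computad on $\mathrm{Pos}(B)$. **Proposition.** Let $n\in\mathbb N$, let $B$ be a Batanin tree and let $A$ be an $n$-sphere of $B$. Then $A$ is full if and only if there exist $n$-cells $a,b$ of $\mathrm{Free}_n\mathrm{Pos}(\partial_nB)$, both covering $\partial_nB$, such that $$\mathrm{pr}_1A=\mathrm{Cell}_n(\mathrm{Free}_n(s_n^B))(a),\qquad \mathrm{pr}_2A=\mathrm{Cell}_n(\mathrm{Free}_n(t_n^B))(b).$$ Moreover, if $\dim B\le n+1$, then $A$ is full if and only if there exists an $(n+1)$-cell of $\mathrm{Free}_{n+1}\mathrm{Pos}(B)$ with boundary $A$ that covers $B$. -/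

import Mathlib

namespace WeakOmega

/-! ### Globular sets -/

/-- A globular set. -/
structure GlobSet where
  cell : ℕ → Type
  src : ∀ {n}, cell (n + 1) → cell n
  tgt : ∀ {n}, cell (n + 1) → cell n
  src_src : ∀ {n} (x : cell (n + 2)), src (src x) = src (tgt x)
  tgt_src : ∀ {n} (x : cell (n + 2)), tgt (src x) = tgt (tgt x)

namespace GlobSet

/-- A morphism of globular sets. -/
structure Hom (X Y : GlobSet) where
  app : ∀ {n}, X.cell n → Y.cell n
  app_src : ∀ {n} (x : X.cell (n + 1)), app (X.src x) = Y.src (app x)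
  app_tgt : ∀ {n} (x : X.cell (n + 1)), app (X.tgt x) = Y.tgt (app x)

/-- Two `n`-cells are parallel when they have common source and target; any two `0`-cells are. -/
def Par (X : GlobSet) : ∀ {n : ℕ}, X.cell n → X.cell n → Prop
  | 0, _, _ => True
  | _ + 1, x, y => X.src x = X.src y ∧ X.tgt x = X.tgt y

theorem par_src_tgt (X : GlobSet) : ∀ {n : ℕ} (x : X.cell (n + 1)), X.Par (X.src x) (X.tgt x)
  | 0, _ => trivial
  | _ + 1, x => ⟨X.src_src x, X.tgt_src x⟩

theorem Hom.map_par {X Y : GlobSet} (f : Hom X Y) :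
    ∀ {n : ℕ} {x y : X.cell n}, X.Par x y → Y.Par (f.app x) (f.app y)
  | 0, _, _, _ => trivial
  | _ + 1, x, y, h => ⟨by rw [← f.app_src, ← f.app_src, h.1], by rw [← f.app_tgt, ← f.app_tgt, h.2]⟩

end GlobSet

/-! ### Batanin trees and their positions -/

/-- Batanin trees, i.e. finite rooted planar trees `br [B₁, …, Bₙ]`. The tree `nil` is `br []`, and
`cons B (br [B₁, …, Bₙ])` is `br [B, B₁, …, Bₙ]`; see `Bat.br` and `Bat.br_bijective`. -/
inductive Bat : Type
  | nil : Bat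
  | cons : Bat → Bat → Bat

namespace Bat

/-- The tree whose root has the given list of branches. -/
def br (L : List Bat) : Bat := L.foldr cons nil

/-- The list of branches at the root. -/
def branches : Bat → List Bat
  | nil => []
  | cons B T => B :: branches T

theorem br_branches : ∀ B : Bat, br B.branches = B
  | nil => rfl
  | cons B T => congrArg (cons B) (br_branches T)

theorem branches_br : ∀ L : List Bat, (br L).branches = L
  | [] => rfl
  | B :: L => congrArg (List.cons B) (branches_br L)

theorem br_bijective : Function.Bijective br :=
  ⟨Function.LeftInverse.injective branches_br, Function.RightInverse.surjective br_branches⟩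

/-- The dimension (height) of a tree. -/
def dim : Bat → ℕ
  | nil => 0
  | cons B T => max (dim B + 1) (dim T)

/-- The globes: `D₀ = br []` and `Dₙ₊₁ = br [Dₙ]`. -/
def globe : ℕ → Bat
  | 0 => nil
  | n + 1 => cons (globe n) nil

/-- The `k`-boundary of a tree: all nodes of height more than `k` are removed. -/
def bdry : ℕ → Bat → Bat
  | _, nil => nil
  | 0, cons _ _ => nil
  | k + 1, cons B T => cons (bdry k B) (bdry (k + 1) T)

/-- `Pos B n` is the set of `n`-dimensional positions of the tree `B`. -/
inductive Pos : Bat → ℕ → Type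
  | here (B : Bat) : Pos B 0
  | inr {B T : Bat} {n : ℕ} (p : Pos T n) : Pos (cons B T) n
  | inl {B T : Bat} {n : ℕ} (q : Pos B n) : Pos (cons B T) (n + 1)

namespace Pos

/-- The source of a position of positive dimension. -/
def src : ∀ {B : Bat} {n : ℕ}, Pos B (n + 1) → Pos B n
  | _, _, inr q => inr (src q)
  | _, 0, inl _ => here _
  | _, _ + 1, inl p => inl (src p)

/-- The target of a position of positive dimension. -/
def tgt : ∀ {B : Bat} {n : ℕ}, Pos B (n + 1) → Pos B n
  | _, _, inr q => inr (tgt q)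
  | _, 0, inl _ => inr (here _)
  | _, _ + 1, inl p => inl (tgt p)

theorem src_src : ∀ {B : Bat} {n : ℕ} (p : Pos B (n + 2)), src (src p) = src (tgt p)
  | _, _, inr q => by simp only [src, tgt, src_src q]
  | _, 0, inl q => by simp only [src, tgt]
  | _, _ + 1, inl q => by simp only [src, tgt, src_src q]

theorem tgt_src : ∀ {B : Bat} {n : ℕ} (p : Pos B (n + 2)), tgt (src p) = tgt (tgt p)
  | _, _, inr q => by simp only [src, tgt, tgt_src q]
  | _, 0, inl q => by simp only [src, tgt]
  | _, _ + 1, inl q => by simp only [src, tgt, tgt_src q]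

/-- A source boundary position is one which is not the target of another position. -/
def IsSourceBdry {B : Bat} {n : ℕ} (p : Pos B n) : Prop := ¬ ∃ q : Pos B (n + 1), tgt q = p

/-- A target boundary position is one which is not the source of another position. -/
def IsTargetBdry {B : Bat} {n : ℕ} (p : Pos B n) : Prop := ¬ ∃ q : Pos B (n + 1), src q = p

end Pos

/-- The globular set of positions of a tree. -/
abbrev pos (B : Bat) : GlobSet where
  cell := Pos B
  src := Pos.src
  tgt := Pos.tgt
  src_src := Pos.src_src
  tgt_src := Pos.tgt_src

/-- The unique top-dimensional position of the `n`-globe. -/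
def globeTop : ∀ n : ℕ, Pos (globe n) n
  | 0 => Pos.here _
  | n + 1 => Pos.inl (globeTop n)

/-- The source inclusion on positions. -/
def sIncl : ∀ (k : ℕ) (B : Bat) {n : ℕ}, Pos (bdry k B) n → Pos B n
  | 0, nil, _, p => p
  | _ + 1, nil, _, p => p
  | 0, cons _ _, _, Pos.here _ => Pos.here _
  | _ + 1, cons _ _, _, Pos.here _ => Pos.here _
  | k + 1, cons B _, _, Pos.inl p => Pos.inl (sIncl k B p)
  | k + 1, cons _ T, _, Pos.inr p => Pos.inr (sIncl (k + 1) T p)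

/-- The target inclusion on positions. -/
def tIncl : ∀ (k : ℕ) (B : Bat) {n : ℕ}, Pos (bdry k B) n → Pos B n
  | 0, nil, _, p => p
  | _ + 1, nil, _, p => p
  | 0, cons _ T, _, Pos.here _ =>
      Pos.inr (tIncl 0 T (Pos.here _))
  | _ + 1, cons _ _, _, Pos.here _ => Pos.here _
  | k + 1, cons B _, _, Pos.inl p => Pos.inl (tIncl k B p)
  | k + 1, cons _ T, _, Pos.inr p => Pos.inr (tIncl (k + 1) T p)

theorem sIncl_here : ∀ (k : ℕ) (B : Bat), sIncl k B (Pos.here _) = Pos.here _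
  | 0, nil => rfl
  | _ + 1, nil => rfl
  | 0, cons _ _ => rfl
  | _ + 1, cons _ _ => rfl

theorem tIncl_here : ∀ (k : ℕ) (B : Bat), tIncl (k + 1) B (Pos.here _) = Pos.here _
  | _, nil => rfl
  | _, cons _ _ => rfl

theorem sIncl_src : ∀ (k : ℕ) (B : Bat) {n : ℕ} (p : Pos (bdry k B) (n + 1)),
    sIncl k B p.src = (sIncl k B p).src
  | 0, nil, _, p => nomatch p
  | _ + 1, nil, _, p => nomatch p
  | 0, cons _ _, _, p => nomatch p
  | k + 1, cons _ T, 0, Pos.inl _ => rfl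
  | k + 1, cons B _, _ + 1, Pos.inl p => congrArg Pos.inl (sIncl_src k B p)
  | k + 1, cons _ T, _, Pos.inr p => congrArg Pos.inr (sIncl_src (k + 1) T p)

theorem sIncl_tgt : ∀ (k : ℕ) (B : Bat) {n : ℕ} (p : Pos (bdry k B) (n + 1)),
    sIncl k B p.tgt = (sIncl k B p).tgt
  | 0, nil, _, p => nomatch p
  | _ + 1, nil, _, p => nomatch p
  | 0, cons _ _, _, p => nomatch p
  | k + 1, cons _ T, 0, Pos.inl _ => congrArg Pos.inr (sIncl_here (k + 1) T)
  | k + 1, cons B _, _ + 1, Pos.inl p => congrArg Pos.inl (sIncl_tgt k B p)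
  | k + 1, cons _ T, _, Pos.inr p => congrArg Pos.inr (sIncl_tgt (k + 1) T p)

theorem tIncl_src : ∀ (k : ℕ) (B : Bat) {n : ℕ} (p : Pos (bdry k B) (n + 1)),
    tIncl k B p.src = (tIncl k B p).src
  | 0, nil, _, p => nomatch p
  | _ + 1, nil, _, p => nomatch p
  | 0, cons _ _, _, p => nomatch p
  | k + 1, cons _ T, 0, Pos.inl _ => rfl
  | k + 1, cons B _, _ + 1, Pos.inl p => congrArg Pos.inl (tIncl_src k B p)
  | k + 1, cons _ T, _, Pos.inr p => congrArg Pos.inr (tIncl_src (k + 1) T p)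

theorem tIncl_tgt : ∀ (k : ℕ) (B : Bat) {n : ℕ} (p : Pos (bdry k B) (n + 1)),
    tIncl k B p.tgt = (tIncl k B p).tgt
  | 0, nil, _, p => nomatch p
  | _ + 1, nil, _, p => nomatch p
  | 0, cons _ _, _, p => nomatch p
  | k + 1, cons _ T, 0, Pos.inl _ => congrArg Pos.inr (tIncl_here k T)
  | k + 1, cons B _, _ + 1, Pos.inl p => congrArg Pos.inl (tIncl_tgt k B p)
  | k + 1, cons _ T, _, Pos.inr p => congrArg Pos.inr (tIncl_tgt (k + 1) T p)

/-- The source inclusion of the `k`-boundary, as a morphism of globular sets. -/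
def srcIncl (k : ℕ) (B : Bat) : GlobSet.Hom (bdry k B).pos B.pos where
  app := sIncl k B
  app_src := sIncl_src k B
  app_tgt := sIncl_tgt k B

/-- The target inclusion of the `k`-boundary, as a morphism of globular sets. -/
def tgtIncl (k : ℕ) (B : Bat) : GlobSet.Hom (bdry k B).pos B.pos where
  app := tIncl k B
  app_src := tIncl_src k B
  app_tgt := tIncl_tgt k B

end Bat

/-! ### Computads

The categories of `n`-computads are defined by recursion on `n`. `Level n` lists the data that the
recursion carries at stage `n`, with the laws needed to make sense of the next stage. The data
themselves are constructed below: `Level.base` is the stage `0`, `Level.next` constructs the stage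
`n + 1` out of the stage `n`, and `level n` is the resulting stage `n`. -/

/-- The data carried by the recursion at stage `n`. -/
structure Level (n : ℕ) where
  /-- `n`-computads -/
  Comp : Type 1
  /-- `n`-homomorphisms -/
  Hom : Comp → Comp → Type
  id : ∀ C, Hom C C
  comp : ∀ {E C D}, Hom C D → Hom E C → Hom E D
  /-- the set of `n`-cells of an `n`-computad -/
  Cell : Comp → Type
  cellMap : ∀ {C D}, Hom C D → Cell C → Cell D
  /-- the set of `n`-spheres of an `n`-computad -/
  Sph : Comp → Type
  sphMap : ∀ {C D}, Hom C D → Sph C → Sph D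
  pr₁ : ∀ {C}, Sph C → Cell C
  pr₂ : ∀ {C}, Sph C → Cell C
  /-- the set of all generators of an `n`-computad, of any dimension `k ≤ n` -/
  Gen : Comp → Type
  /-- the support of a cell: the disjoint union over `k` of its `k`-dimensional supports -/
  supp : ∀ {C}, Cell C → Set (Gen C)
  /-- the support of a homomorphism -/
  homSupp : ∀ {D C}, Hom D C → Set (Gen C)
  /-- the `n`-computad associated to a globular set -/
  free : GlobSet → Comp
  freeMap : ∀ {X Y : GlobSet}, GlobSet.Hom X Y → Hom (free X) (free Y)
  /-- an `n`-cell of a globular set, seen as a generator cell -/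
  genCell : ∀ {X : GlobSet}, X.cell n → Cell (free X)
  /-- a parallel pair of `n`-cells of a globular set, seen as a sphere of generator cells -/
  parSph : ∀ (X : GlobSet) (x y : X.cell n), X.Par x y → Sph (free X)
  /-- the full `n`-spheres of a Batanin tree -/
  Full : ∀ B : Bat, Sph (free B.pos) → Prop
  id_comp : ∀ {C D} (σ : Hom C D), comp (id D) σ = σ
  comp_id : ∀ {C D} (σ : Hom C D), comp σ (id C) = σ
  assoc : ∀ {C₁ C₂ C₃ C₄} (ρ : Hom C₃ C₄) (σ : Hom C₂ C₃) (τ : Hom C₁ C₂),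
    comp (comp ρ σ) τ = comp ρ (comp σ τ)
  sphMap_id : ∀ {C} (A : Sph C), sphMap (id C) A = A
  sphMap_comp : ∀ {E C D} (σ : Hom C D) (τ : Hom E C) (A : Sph E),
    sphMap (comp σ τ) A = sphMap σ (sphMap τ A)
  sphMap_parSph : ∀ {X Y} (f : GlobSet.Hom X Y) (x y : X.cell n) (h : X.Par x y),
    sphMap (freeMap f) (parSph X x y h) = parSph Y (f.app x) (f.app y) (f.map_par h)

namespace Level

/-- Stage `0`: a `0`-computad is a set, its cells are its elements, and its spheres are pairs of
elements. -/
def base : Level 0 where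
  Comp := Type
  Hom C D := C → D
  id _ := fun x => x
  comp σ τ := fun x => σ (τ x)
  Cell C := C
  cellMap σ c := σ c
  Sph C := C × C
  sphMap σ A := (σ A.1, σ A.2)
  pr₁ A := A.1
  pr₂ A := A.2
  Gen C := C
  supp c := {c}
  homSupp {D _} σ := ⋃ v : D, {σ v}
  free X := X.cell 0
  freeMap f := fun x => f.app x
  genCell x := x
  parSph _ x y _ := (x, y)
  Full _ A := A.1.IsSourceBdry ∧ A.2.IsTargetBdry
  id_comp _ := rfl
  comp_id _ := rfl
  assoc _ _ _ := rfl
  sphMap_id _ := rfl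
  sphMap_comp _ _ _ := rfl
  sphMap_parSph _ _ _ _ := rfl

section Next

variable {n : ℕ} (L : Level n)

/-- An `(n+1)`-computad: an `n`-computad, with a set of generators attached along `n`-spheres. -/
structure NComp where
  base : L.Comp
  V : Type
  φ : V → L.Sph base

/-- The `(n+1)`-computad associated to a globular set. -/
abbrev nfree (X : GlobSet) : L.NComp where
  base := L.free X
  V := X.cell (n + 1)
  φ x := L.parSph X (X.src x) (X.tgt x) (X.par_src_tgt x)

/-- `L.NCell C A` is the set of `(n+1)`-cells of `C` whose boundary is the `n`-sphere `A`. The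
arguments `τ` and `τV` of a coherence cell are the two components of an `(n+1)`-homomorphism
from the free computad on the tree to `C` (see `NHom`); `S` is its full sphere. -/
inductive NCell (C : L.NComp) : L.Sph C.base → Type
  | var (v : C.V) {A : L.Sph C.base} (h : C.φ v = A) : NCell C A
  | coh (B : Bat) (hB : B.dim ≤ n + 1) (S : L.Sph (L.free B.pos)) (hS : L.Full B S)
      (τ : L.Hom (L.nfree B.pos).base C.base)
      (τV : ∀ p : (L.nfree B.pos).V, NCell C (L.sphMap τ ((L.nfree B.pos).φ p)))
      {A : L.Sph C.base} (h : L.sphMap τ S = A) : NCell C A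

/-- An `(n+1)`-homomorphism. -/
structure NHom (D C : L.NComp) where
  base : L.Hom D.base C.base
  onV : ∀ v : D.V, L.NCell C (L.sphMap base (D.φ v))

/-- An `n`-sphere of the underlying `n`-computad together with two cells with this boundary. -/
structure NSph (C : L.NComp) where
  bd : L.Sph C.base
  fst : L.NCell C bd
  snd : L.NCell C bd

variable {L}

namespace NCell

/-- Transport of a cell along an equality of boundaries. -/
def retype {C : L.NComp} {A A' : L.Sph C.base} (e : A = A') : L.NCell C A → L.NCell C A'
  | var v h => var v (h.trans e)
  | coh B hB S hS τ τV h => coh B hB S hS τ τV (h.trans e)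

/-- The action of a homomorphism on cells. -/
def map {C D : L.NComp} (σ : L.NHom C D) {A : L.Sph C.base} :
    L.NCell C A → ∀ {A' : L.Sph D.base}, L.sphMap σ.base A = A' → L.NCell D A'
  | var v h, _, e => (σ.onV v).retype (by rw [h, e])
  | coh B hB S hS τ τV h, _, e =>
      coh B hB S hS (L.comp σ.base τ)
        (fun p => map σ (τV p) (L.sphMap_comp σ.base τ _).symm)
        (by rw [L.sphMap_comp, h, e])

/-- The `(n+1)`-dimensional support of an `(n+1)`-cell. -/
def topSupp {C : L.NComp} {A : L.Sph C.base} : L.NCell C A → Set C.V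
  | var v _ => {v}
  | coh _ _ _ _ _ τV _ => ⋃ p, topSupp (τV p)

/-- The support of an `(n+1)`-cell, in all dimensions: the left summand consists of the generators
of dimension at most `n`, and the right summand of those of dimension `n + 1`. -/
def supp {C : L.NComp} {A : L.Sph C.base} : L.NCell C A → Set (L.Gen C.base ⊕ C.V)
  | var v _ =>
      {Sum.inr v} ∪ Sum.inl '' (L.supp (L.pr₁ (C.φ v)) ∪ L.supp (L.pr₂ (C.φ v)))
  | coh _ _ _ _ τ τV _ => Sum.inl '' L.homSupp τ ∪ ⋃ p, supp (τV p)

theorem retype_rfl {C : L.NComp} {A : L.Sph C.base} (c : L.NCell C A) : c.retype rfl = c := by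
  cases c <;> rfl

theorem retype_retype {C : L.NComp} {A A' A'' : L.Sph C.base} (e : A = A') (e' : A' = A'')
    (c : L.NCell C A) : (c.retype e).retype e' = c.retype (e.trans e') := by
  cases c <;> rfl

end NCell

/-- The identity homomorphism. -/
abbrev NHom.id (C : L.NComp) : L.NHom C C where
  base := L.id C.base
  onV v := NCell.var v (L.sphMap_id _).symm

/-- Composition of homomorphisms. -/
abbrev NHom.comp {E C D : L.NComp} (σ : L.NHom C D) (τ : L.NHom E C) : L.NHom E D where
  base := L.comp σ.base τ.base
  onV v := (τ.onV v).map σ (L.sphMap_comp σ.base τ.base _).symm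

/-- The action of a homomorphism on spheres. -/
abbrev NSph.map {C D : L.NComp} (σ : L.NHom C D) (A : L.NSph C) : L.NSph D where
  bd := L.sphMap σ.base A.bd
  fst := A.fst.map σ rfl
  snd := A.snd.map σ rfl

/-- The action of a morphism of globular sets on free computads. -/
abbrev nfreeMap {X Y : GlobSet} (f : GlobSet.Hom X Y) : L.NHom (L.nfree X) (L.nfree Y) where
  base := L.freeMap f
  onV x := NCell.var (f.app x) (by
    refine Eq.trans ?_ (L.sphMap_parSph f _ _ _).symm
    simp only [nfree, f.app_src, f.app_tgt])

theorem NCell.map_retype {C D : L.NComp} (σ : L.NHom C D) {A A' : L.Sph C.base} (e : A = A')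
    (c : L.NCell C A) {A'' : L.Sph D.base} (h : L.sphMap σ.base A' = A'') :
    (c.retype e).map σ h = c.map σ (e ▸ h) := by
  subst e; rw [retype_rfl]

theorem NCell.retype_map {C D : L.NComp} (σ : L.NHom C D) {A : L.Sph C.base}
    (c : L.NCell C A) {A' A'' : L.Sph D.base} (h : L.sphMap σ.base A = A') (e : A' = A'') :
    (c.map σ h).retype e = c.map σ (h.trans e) := by
  subst e; rw [retype_rfl]

theorem NHom.ext {C D : L.NComp} {σ τ : L.NHom C D} (h : σ.base = τ.base)
    (h' : ∀ v, (σ.onV v).retype (by rw [h]) = τ.onV v) : σ = τ := by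
  obtain ⟨σ₀, σV⟩ := σ
  obtain ⟨τ₀, τV⟩ := τ
  obtain rfl : σ₀ = τ₀ := h
  congr 1
  funext v
  exact (NCell.retype_rfl _).symm.trans (h' v)

theorem NSph.ext {C : L.NComp} {A A' : L.NSph C} (h : A.bd = A'.bd)
    (h₁ : A.fst.retype h = A'.fst) (h₂ : A.snd.retype h = A'.snd) : A = A' := by
  obtain ⟨A, a, b⟩ := A
  obtain ⟨A', a', b'⟩ := A'
  obtain rfl : A = A' := h
  obtain rfl : a = a' := (NCell.retype_rfl _).symm.trans h₁
  obtain rfl : b = b' := (NCell.retype_rfl _).symm.trans h₂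
  rfl

theorem NCell.coh_congr {C : L.NComp} {B : Bat} {hB : B.dim ≤ n + 1} {S : L.Sph (L.free B.pos)}
    {hS : L.Full B S} {τ τ' : L.Hom (L.nfree B.pos).base C.base} (e : τ = τ')
    {τV : ∀ p : (L.nfree B.pos).V, L.NCell C (L.sphMap τ ((L.nfree B.pos).φ p))}
    {τV' : ∀ p : (L.nfree B.pos).V, L.NCell C (L.sphMap τ' ((L.nfree B.pos).φ p))}
    (eV : ∀ p, (τV p).retype (by rw [e]) = τV' p)
    {A : L.Sph C.base} (h : L.sphMap τ S = A) (h' : L.sphMap τ' S = A) :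
    coh B hB S hS τ τV h = coh B hB S hS τ' τV' h' := by
  subst e
  congr 1
  funext p
  exact (NCell.retype_rfl _).symm.trans (eV p)

theorem NCell.map_id {C : L.NComp} {A : L.Sph C.base} (c : L.NCell C A) {A' : L.Sph C.base}
    (h : L.sphMap (NHom.id C).base A = A') :
    c.map (NHom.id C) h = c.retype ((L.sphMap_id A).symm.trans h) := by
  induction c generalizing A' with
  | var v e => rfl
  | coh B hB S hS τ τV e ih =>
    refine NCell.coh_congr (L.id_comp τ) (fun p => ?_) _ _
    exact (congrArg _ (ih p _)).trans ((retype_retype _ _ _).trans (retype_rfl _))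

theorem NCell.map_comp {E C D : L.NComp} (σ : L.NHom C D) (τ : L.NHom E C) {A : L.Sph E.base}
    (c : L.NCell E A) {A' : L.Sph C.base} {A'' : L.Sph D.base}
    (h : L.sphMap (σ.comp τ).base A = A'') (h₁ : L.sphMap τ.base A = A')
    (h₂ : L.sphMap σ.base A' = A'') :
    c.map (σ.comp τ) h = (c.map τ h₁).map σ h₂ := by
  induction c generalizing A' A'' with
  | var v e =>
    exact (retype_map σ (τ.onV v) _ _).trans (map_retype σ _ (τ.onV v) _).symm
  | coh B hB S hS ρ ρV e ih =>
    refine NCell.coh_congr (L.assoc _ _ _) (fun p => ?_) _ _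
    exact (retype_map (σ.comp τ) (ρV p) _ _).trans (ih p _ _ _)

end Next

/-- Stage `n + 1`. -/
def next {n : ℕ} (L : Level n) : Level (n + 1) where
  Comp := L.NComp
  Hom := L.NHom
  id := NHom.id
  comp := NHom.comp
  Cell C := Σ A : L.Sph C.base, L.NCell C A
  cellMap σ c := ⟨L.sphMap σ.base c.1, c.2.map σ rfl⟩
  Sph := L.NSph
  sphMap := NSph.map
  pr₁ A := ⟨A.bd, A.fst⟩
  pr₂ A := ⟨A.bd, A.snd⟩
  Gen C := L.Gen C.base ⊕ C.V
  supp c := c.2.supp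
  homSupp σ := Sum.inl '' L.homSupp σ.base ∪ ⋃ v, (σ.onV v).supp
  free := L.nfree
  freeMap := nfreeMap
  genCell {X} x := ⟨(L.nfree X).φ x, NCell.var x rfl⟩
  parSph X x y h :=
    { bd := (L.nfree X).φ x
      fst := NCell.var x rfl
      snd := NCell.var y (by simp only [nfree, h.1, h.2]) }
  Full B A := A.fst.topSupp = {p : B.Pos (n + 1) | p.IsSourceBdry} ∧
    A.snd.topSupp = {p : B.Pos (n + 1) | p.IsTargetBdry} ∧ L.Full B A.bd
  id_comp σ := NHom.ext (L.id_comp _) fun v =>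
    (congrArg _ (NCell.map_id (σ.onV v) _)).trans
      ((NCell.retype_retype _ _ _).trans (NCell.retype_rfl _))
  comp_id σ := NHom.ext (L.comp_id _) fun v =>
    (NCell.retype_retype
      (by rw [L.comp_id] : _ = L.sphMap (L.comp σ.base (L.id _)) _) _ (σ.onV v)).trans
        (NCell.retype_rfl _)
  assoc ρ σ τ := NHom.ext (L.assoc _ _ _) fun v =>
    (NCell.retype_map (ρ.comp σ) (τ.onV v) _ _).trans (NCell.map_comp ρ σ (τ.onV v) _ _ _)
  sphMap_id A := NSph.ext (L.sphMap_id _)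
    ((congrArg _ (NCell.map_id A.fst _)).trans
      ((NCell.retype_retype _ _ _).trans (NCell.retype_rfl _)))
    ((congrArg _ (NCell.map_id A.snd _)).trans
      ((NCell.retype_retype _ _ _).trans (NCell.retype_rfl _)))
  sphMap_comp σ τ A := NSph.ext (L.sphMap_comp _ _ _)
    ((NCell.retype_map (σ.comp τ) A.fst _ _).trans (NCell.map_comp σ τ A.fst _ _ _))
    ((NCell.retype_map (σ.comp τ) A.snd _ _).trans (NCell.map_comp σ τ A.snd _ _ _))
  sphMap_parSph f x y h := NSph.ext
    (by
      refine (L.sphMap_parSph f _ _ _).trans ?_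
      simp only [f.app_src, f.app_tgt])
    rfl rfl

end Level

/-- The recursion: stage `n` of the definition of computads. -/
def level : ∀ n : ℕ, Level n
  | 0 => Level.base
  | n + 1 => (level n).next

/-- `n`-computads. -/
abbrev Comp (n : ℕ) : Type 1 := (level n).Comp

/-- `n`-homomorphisms. -/
abbrev Hom {n : ℕ} (D C : Comp n) : Type := (level n).Hom D C

/-- The set of `n`-cells of an `n`-computad. -/
abbrev Cell {n : ℕ} (C : Comp n) : Type := (level n).Cell C

/-- The action of an `n`-homomorphism on `n`-cells. -/
abbrev cellMap {n : ℕ} {C D : Comp n} (σ : Hom C D) : Cell C → Cell D := (level n).cellMap σ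

/-- The set of `n`-spheres of an `n`-computad. -/
abbrev Sph {n : ℕ} (C : Comp n) : Type := (level n).Sph C

/-- The first cell of a sphere. -/
abbrev pr₁ {n : ℕ} {C : Comp n} (A : Sph C) : Cell C := (level n).pr₁ A

/-- The second cell of a sphere. -/
abbrev pr₂ {n : ℕ} {C : Comp n} (A : Sph C) : Cell C := (level n).pr₂ A

/-- The underlying `n`-computad of an `(n+1)`-computad. -/
def under {n : ℕ} (C : Comp (n + 1)) : Comp n := Level.NComp.base C

/-- The boundary sphere of an `(n+1)`-cell. -/
def ty {n : ℕ} {C : Comp (n + 1)} (c : Cell C) : Sph (under C) := Sigma.fst c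

/-- The `n`-computad associated to a globular set. -/
abbrev free (n : ℕ) (X : GlobSet) : Comp n := (level n).free X

/-- The functorial action of `free`. -/
abbrev freeMap (n : ℕ) {X Y : GlobSet} (f : GlobSet.Hom X Y) : Hom (free n X) (free n Y) :=
  (level n).freeMap f

/-- The full `n`-spheres of a Batanin tree. -/
abbrev Full {n : ℕ} (B : Bat) (A : Sph (free n B.pos)) : Prop := (level n).Full B A

/-- A homomorphism is a cover when its support consists of all generators of its target. -/
def IsCover {n : ℕ} {D C : Comp n} (σ : Hom D C) : Prop := (level n).homSupp σ = Set.univ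

/-- An `n`-cell `c` of `C` covers `C` when the corresponding homomorphism from the `n`-globe to
`C`, i.e. the one that sends the top generator of the globe to `c`, is a cover. -/
def Covers {n : ℕ} {C : Comp n} (c : Cell C) : Prop :=
  ∃ σ : Hom (free n (Bat.globe n).pos) C,
    cellMap σ ((level n).genCell (X := (Bat.globe n).pos) (Bat.globeTop n)) = c ∧ IsCover σ

end WeakOmega

namespace WeakOmega

/-! ### Combinatorics of positions -/

namespace GlobSet

/-! The hard implication is that a cell covering `B` has full boundary. Supports are too coarse for
this, so top-dimensional generators are counted with multiplicity (`gens`), which gives a Stokes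
formula (`Supports.stokes`): for an (n+1)-cell `c` from `a` to `b`, `gens a + tgt (gens c) = gens b
+ src (gens c)`.

On the positions of a tree this formula is tested against the step functions `after r`. Along a
parallel class of n-positions, `after r` jumps by one exactly across the (n+1)-positions parallel to
`r` (`after_tgt`), it vanishes on source boundary positions, and it is at most one. Two consequences
follow. If the boundary of `c` is full, then `c` contains exactly one generator, with multiplicity
one, from each parallel class (`countP_gens`). Conversely, if `a` and `b` contain each class once
and `c` meets every class of (n+1)-positions, then `a` consists of the source boundary positions and
`b` of the target boundary ones (`mem_iff_bdry`).

Fullness of the boundary of a covering cell is then proved by descending through the dimensions. The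
class hypotheses survive the descent because every generator of dimension at most n in a cell is
equal or parallel to one in its source (`exists_rel`). Conversely, a full sphere is filled by the
coherence cell over the identity, which is a cover.

For the first equivalence, the support of the first cell of a full sphere is exactly the image of
the generators of `∂ₙB` under `s`, and similarly for the second cell and `t`. Cells lift along
injective maps when their support does, and the lifts are covers. In the other direction, the
boundary of a covering cell `a` of `∂ₙB` is full by the hard implication, and `s` carries it to a
full sphere of `B`.

The facts about supports, multiplicities and liftings are bundled in `Supports` and carried through
the same recursion as the computads. -/

theorem Par.refl (X : GlobSet) : ∀ {n : ℕ} (x : X.cell n), X.Par x x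
  | 0, _ => trivial
  | _ + 1, _ => ⟨rfl, rfl⟩

theorem Par.symm {X : GlobSet} : ∀ {n : ℕ} {x y : X.cell n}, X.Par x y → X.Par y x
  | 0, _, _, _ => trivial
  | _ + 1, _, _, h => ⟨h.1.symm, h.2.symm⟩

theorem Par.trans {X : GlobSet} : ∀ {n : ℕ} {x y z : X.cell n}, X.Par x y → X.Par y z → X.Par x z
  | 0, _, _, _, _, _ => trivial
  | _ + 1, _, _, _, h, h' => ⟨h.1.trans h'.1, h.2.trans h'.2⟩

end GlobSet

namespace Bat

namespace Pos

variable {B T : Bat} {n : ℕ}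

/-! ### Boundaries and parallelism on the constructors of positions -/

@[simp] theorem src_inr (q : Pos T (n + 1)) : src (inr (B := B) q) = inr (src q) := by
  simp only [src]
@[simp] theorem tgt_inr (q : Pos T (n + 1)) : tgt (inr (B := B) q) = inr (tgt q) := by
  simp only [tgt]
@[simp] theorem src_inl_zero (q : Pos B 0) : src (inl (T := T) q) = here _ := rfl
@[simp] theorem tgt_inl_zero (q : Pos B 0) : tgt (inl (T := T) q) = inr (here _) := rfl
@[simp] theorem src_inl_succ (q : Pos B (n + 1)) : src (inl (T := T) q) = inl (src q) := rfl
@[simp] theorem tgt_inl_succ (q : Pos B (n + 1)) : tgt (inl (T := T) q) = inl (tgt q) := rfl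

theorem par_inr : ∀ {n : ℕ} {x y : Pos T n},
    (cons B T).pos.Par (inr x) (inr y) ↔ T.pos.Par x y
  | 0, _, _ => Iff.rfl
  | _ + 1, x, y => by simp [GlobSet.Par]

theorem par_inl : ∀ {n : ℕ} {x y : Pos B n},
    (cons B T).pos.Par (inl x) (inl y) ↔ B.pos.Par x y
  | 0, _, _ => by simp [GlobSet.Par]
  | _ + 1, x, y => by simp [GlobSet.Par]

theorem not_par_inl_inr : ∀ {n : ℕ} {x : Pos B n} {y : Pos T (n + 1)},
    ¬ (cons B T).pos.Par (inl x) (inr y)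
  | 0, _, _ => by simp [GlobSet.Par]
  | _ + 1, x, y => by simp [GlobSet.Par]

theorem not_par_inr_inl {x : Pos B n} {y : Pos T (n + 1)} :
    ¬ (cons B T).pos.Par (inr y) (inl x) := fun h => not_par_inl_inr h.symm

theorem elim_nil_succ (p : Pos nil (n + 1)) : False := nomatch p

theorem isSourceBdry_here (B : Bat) : IsSourceBdry (here B) := by
  rintro ⟨q, hq⟩
  cases q <;> simp at hq

/-- The 0-positions form a chain starting at `here`, and each later one is the target of a
1-position ending there. -/
theorem not_isSourceBdry_inr_zero (p : Pos T 0) : ¬ IsSourceBdry (inr (B := B) p) := by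
  simp only [IsSourceBdry, not_not]
  induction T generalizing B with
  | nil => cases p; exact ⟨inl (here _), rfl⟩
  | cons C U _ ih =>
    cases p with
    | here => exact ⟨inl (here _), rfl⟩
    | inr p =>
      obtain ⟨q, hq⟩ := ih (B := C) p
      exact ⟨inr q, by rw [tgt_inr, hq]⟩

theorem isSourceBdry_inr {p : Pos T (n + 1)} :
    IsSourceBdry (inr (B := B) p) ↔ IsSourceBdry p := by
  refine not_congr ⟨?_, fun ⟨q, hq⟩ => ⟨inr q, by rw [tgt_inr, hq]⟩⟩
  rintro ⟨q, hq⟩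
  cases q with
  | inr q => exact ⟨q, by simpa using hq⟩
  | inl q => simp at hq

theorem isSourceBdry_inl {p : Pos B n} :
    IsSourceBdry (inl (T := T) p) ↔ IsSourceBdry p := by
  refine not_congr ⟨?_, fun ⟨q, hq⟩ => ⟨inl q, by rw [tgt_inl_succ, hq]⟩⟩
  rintro ⟨q, hq⟩
  cases q with
  | inr q => simp at hq
  | inl q => exact ⟨q, by simpa using hq⟩

theorem isTargetBdry_here_nil : IsTargetBdry (here nil) := fun ⟨q, _⟩ => elim_nil_succ q

theorem not_isTargetBdry_here_cons : ¬ IsTargetBdry (here (cons B T)) :=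
  not_not.2 ⟨inl (here _), rfl⟩

theorem isTargetBdry_inr {p : Pos T n} :
    IsTargetBdry (inr (B := B) p) ↔ IsTargetBdry p := by
  refine not_congr ⟨?_, fun ⟨q, hq⟩ => ⟨inr q, by rw [src_inr, hq]⟩⟩
  rintro ⟨q, hq⟩
  cases q with
  | inr q => exact ⟨q, by simpa using hq⟩
  | inl q => cases n <;> simp at hq

theorem isTargetBdry_inl {p : Pos B n} :
    IsTargetBdry (inl (T := T) p) ↔ IsTargetBdry p := by
  refine not_congr ⟨?_, fun ⟨q, hq⟩ => ⟨inl q, by rw [src_inl_succ, hq]⟩⟩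
  rintro ⟨q, hq⟩
  cases q with
  | inr q => simp at hq
  | inl q => exact ⟨q, by simpa using hq⟩

/-! Every class of parallel positions has a unique source boundary member and a unique target
boundary member. -/

theorem exists_par_isSourceBdry : ∀ {B : Bat} {n : ℕ} (x : Pos B n),
    ∃ y : Pos B n, B.pos.Par x y ∧ IsSourceBdry y
  | _, 0, _ => ⟨here _, trivial, isSourceBdry_here _⟩
  | _, _ + 1, inr x =>
      let ⟨y, h, h'⟩ := exists_par_isSourceBdry x
      ⟨inr y, par_inr.2 h, isSourceBdry_inr.2 h'⟩
  | _, _ + 1, inl x =>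
      let ⟨y, h, h'⟩ := exists_par_isSourceBdry x
      ⟨inl y, par_inl.2 h, isSourceBdry_inl.2 h'⟩

theorem exists_isTargetBdry_zero : ∀ B : Bat, ∃ y : Pos B 0, IsTargetBdry y
  | nil => ⟨here _, isTargetBdry_here_nil⟩
  | cons _ T =>
      let ⟨y, h'⟩ := exists_isTargetBdry_zero T
      ⟨inr y, isTargetBdry_inr.2 h'⟩

theorem exists_par_isTargetBdry : ∀ {B : Bat} {n : ℕ} (x : Pos B n),
    ∃ y : Pos B n, B.pos.Par x y ∧ IsTargetBdry y
  | B, 0, _ =>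
      let ⟨y, h⟩ := exists_isTargetBdry_zero B
      ⟨y, trivial, h⟩
  | _, _ + 1, inr x =>
      let ⟨y, h, h'⟩ := exists_par_isTargetBdry x
      ⟨inr y, par_inr.2 h, isTargetBdry_inr.2 h'⟩
  | _, _ + 1, inl x =>
      let ⟨y, h, h'⟩ := exists_par_isTargetBdry x
      ⟨inl y, par_inl.2 h, isTargetBdry_inl.2 h'⟩

theorem IsSourceBdry.eq_of_par : ∀ {B : Bat} {n : ℕ} {x y : Pos B n}, IsSourceBdry x →
    IsSourceBdry y → B.pos.Par x y → x = y
  | _, 0, here _, here _, _, _, _ => rfl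
  | _, 0, inr _, _, h, _, _ => (not_isSourceBdry_inr_zero _ h).elim
  | _, 0, _, inr _, _, h, _ => (not_isSourceBdry_inr_zero _ h).elim
  | _, _ + 1, inr _, inr _, h, h', e => congrArg inr
      (eq_of_par (isSourceBdry_inr.1 h) (isSourceBdry_inr.1 h') (par_inr.1 e))
  | _, _ + 1, inl _, inl _, h, h', e => congrArg inl
      (eq_of_par (isSourceBdry_inl.1 h) (isSourceBdry_inl.1 h') (par_inl.1 e))
  | _, _ + 1, inr _, inl _, _, _, e => (not_par_inr_inl e).elim
  | _, _ + 1, inl _, inr _, _, _, e => (not_par_inl_inr e).elim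

theorem IsTargetBdry.eq_of_par : ∀ {B : Bat} {n : ℕ} {x y : Pos B n}, IsTargetBdry x →
    IsTargetBdry y → B.pos.Par x y → x = y
  | nil, 0, here _, here _, _, _, _ => rfl
  | cons _ _, 0, here _, _, h, _, _ => (not_isTargetBdry_here_cons h).elim
  | cons _ _, 0, _, here _, _, h, _ => (not_isTargetBdry_here_cons h).elim
  | cons _ _, 0, inr _, inr _, h, h', _ => congrArg inr
      (eq_of_par (isTargetBdry_inr.1 h) (isTargetBdry_inr.1 h') trivial)
  | _, _ + 1, inr _, inr _, h, h', e => congrArg inr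
      (eq_of_par (isTargetBdry_inr.1 h) (isTargetBdry_inr.1 h') (par_inr.1 e))
  | _, _ + 1, inl _, inl _, h, h', e => congrArg inl
      (eq_of_par (isTargetBdry_inl.1 h) (isTargetBdry_inl.1 h') (par_inl.1 e))
  | _, _ + 1, inr _, inl _, _, _, e => (not_par_inr_inl e).elim
  | _, _ + 1, inl _, inr _, _, _, e => (not_par_inl_inr e).elim

/-- The index of a position among the siblings, summed along the branch. -/
def rank : ∀ {B : Bat} {n : ℕ}, Pos B n → ℕ
  | _, _, here _ => 0
  | _, _, inr p => rank p + 1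
  | _, _, inl p => rank p

/-- Shows that passing from `tgt r` to `src r` cannot be repeated forever, which drives the
induction in `exists_rel`. -/
theorem rank_src_lt : ∀ {B : Bat} {n : ℕ} (p : Pos B (n + 1)), rank (src p) < rank (tgt p)
  | _, _, inr q => by simpa [rank] using rank_src_lt q
  | _, 0, inl q => by simp [rank]
  | _, _ + 1, inl q => by simpa [rank] using rank_src_lt q

/-- `after r x` is `1` if `x` is parallel to `tgt r` and comes after `r`, and `0` otherwise. -/
def after : ∀ {B : Bat} {n : ℕ}, Pos B (n + 1) → Pos B n → ℕ
  | _, 0, _, here _ => 0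
  | _, _, inr q, inr x => after q x
  | _, 0, inl _, inr _ => 1
  | _, _ + 1, inl q, inl x => after q x
  | _, _ + 1, inl _, inr _ => 0
  | _, _ + 1, inr _, inl _ => 0

@[simp] theorem after_here (r : Pos B 1) : after r (here B) = 0 := by
  cases r <;> simp [after]
@[simp] theorem after_inr_inr (r : Pos T (n + 1)) (x : Pos T n) :
    after (inr (B := B) r) (inr x) = after r x := by
  cases n <;> simp [after]
@[simp] theorem after_inr_inl (r : Pos T (n + 2)) (x : Pos B n) :
    after (inr (B := B) r) (inl x) = 0 := by simp [after]
@[simp] theorem after_inl_inl (r : Pos B (n + 1)) (x : Pos B n) :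
    after (inl (T := T) r) (inl x) = after r x := by simp [after]
@[simp] theorem after_inl_zero_inr (r : Pos B 0) (x : Pos T 0) :
    after (inl (T := T) r) (inr x) = 1 := by simp [after]
@[simp] theorem after_inl_succ_inr (r : Pos B (n + 1)) (x : Pos T (n + 1)) :
    after (inl (T := T) r) (inr x) = 0 := by simp [after]

-- A discrete fundamental theorem of calculus: `after r` is a step function whose jumps are the
-- positions parallel to `r`. Summed over a multiset, the difference of its values on targets and
-- sources counts the class of `r`.
open Classical in
theorem after_tgt : ∀ {B : Bat} {n : ℕ} (r q : Pos B (n + 1)),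
    after r (tgt q) = after r (src q) + if B.pos.Par r q then 1 else 0
  | _, _, inr r, inr q => by simp [par_inr, after_tgt r q]
  | _, 0, inr r, inl q => by simp [not_par_inr_inl]
  | _, 0, inl r, inr q => by simp [not_par_inl_inr]
  | _, 0, inl r, inl q => by simp [GlobSet.Par]
  | _, _ + 1, inr r, inl q => by simp [not_par_inr_inl]
  | _, _ + 1, inl r, inr q => by simp [not_par_inl_inr]
  | _, _ + 1, inl r, inl q => by simp [par_inl, after_tgt r q]

theorem after_eq_zero_of_isSourceBdry : ∀ {B : Bat} {n : ℕ} (r : Pos B (n + 1)) {x : Pos B n},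
    IsSourceBdry x → after r x = 0
  | _, 0, _, here _, _ => after_here _
  | _, 0, _, inr _, h => (not_isSourceBdry_inr_zero _ h).elim
  | _, _ + 1, inr r, inr _, h => by
      simp [after_eq_zero_of_isSourceBdry r (isSourceBdry_inr.1 h)]
  | _, _ + 1, inl r, inl _, h => by
      simp [after_eq_zero_of_isSourceBdry r (isSourceBdry_inl.1 h)]
  | _, _ + 1, inl _, inr _, _ => by simp
  | _, _ + 1, inr _, inl _, _ => by simp

open Classical in
theorem after_of_isTargetBdry : ∀ {B : Bat} {n : ℕ} (r : Pos B (n + 1)) {x : Pos B n},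
    IsTargetBdry x → after r x = if B.pos.Par (tgt r) x then 1 else 0
  | cons _ _, 0, _, here _, h => (not_isTargetBdry_here_cons h).elim
  | _, 0, inr r, inr _, h => by
      simp [after_of_isTargetBdry r (isTargetBdry_inr.1 h), GlobSet.Par]
  | _, 0, inl r, inr _, h => by simp [GlobSet.Par]
  | _, _ + 1, inr r, inr _, h => by
      simp [after_of_isTargetBdry r (isTargetBdry_inr.1 h), par_inr]
  | _, _ + 1, inl r, inl _, h => by
      simp [after_of_isTargetBdry r (isTargetBdry_inl.1 h), par_inl]
  | _, _ + 1, inl _, inr _, _ => by simp [not_par_inl_inr]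
  | _, _ + 1, inr _, inl _, _ => by simp [not_par_inr_inl]

open Classical in
theorem after_le : ∀ {B : Bat} {n : ℕ} (r : Pos B (n + 1)) (x : Pos B n),
    after r x ≤ if B.pos.Par (tgt r) x then 1 else 0
  | _, 0, _, here _ => by simp
  | _, 0, inr r, inr x => by
      simpa [GlobSet.Par] using after_le r x
  | _, 0, inl r, inr _ => by simp [GlobSet.Par]
  | _, _ + 1, inr r, inr x => by simpa [par_inr] using after_le r x
  | _, _ + 1, inl r, inl x => by simpa [par_inl] using after_le r x
  | _, _ + 1, inl _, inr _ => by simp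
  | _, _ + 1, inr _, inl _ => by simp

theorem par_src_tgt (r : Pos B (n + 1)) : B.pos.Par (src r) (tgt r) := B.pos.par_src_tgt r

theorem after_tgt_self (r : Pos B (n + 1)) : after r (tgt r) = 1 ∧ after r (src r) = 0 := by
  classical
  have h := after_tgt r r
  have h' := after_le r (tgt r)
  rw [if_pos (GlobSet.Par.refl _ _)] at h h'
  omega

/-! ### Finiteness and the effect of a height bound -/

instance finite : ∀ (B : Bat) (n : ℕ), Finite (Pos B n)
  | nil, 0 => Finite.of_surjective (fun _ : Unit => here _) fun x => ⟨(), by cases x; rfl⟩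
  | nil, n + 1 => ⟨⟨fun x => (elim_nil_succ x).elim, Fin.elim0, fun x => (elim_nil_succ x).elim,
      fun x => x.elim0⟩⟩
  | cons B T, 0 =>
      have := finite T 0
      Finite.of_surjective (Option.elim · (here _) inr) fun x => by
        cases x with
        | here => exact ⟨none, rfl⟩
        | inr x => exact ⟨some x, rfl⟩
  | cons B T, n + 1 =>
      have := finite T (n + 1)
      have := finite B n
      Finite.of_surjective (Sum.elim inl inr) fun x => by
        cases x with
        | inl x => exact ⟨.inl x, rfl⟩
        | inr x => exact ⟨.inr x, rfl⟩

noncomputable instance fintype (B : Bat) (n : ℕ) : Fintype (Pos B n) := Fintype.ofFinite _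

open Classical in
/-- The finite set of source boundary positions. -/
noncomputable def sourceBdry (B : Bat) (n : ℕ) : Finset (Pos B n) :=
  Finset.univ.filter IsSourceBdry

open Classical in
/-- The finite set of target boundary positions. -/
noncomputable def targetBdry (B : Bat) (n : ℕ) : Finset (Pos B n) :=
  Finset.univ.filter IsTargetBdry

theorem mem_sourceBdry {x : Pos B n} : x ∈ sourceBdry B n ↔ IsSourceBdry x := by
  simp [sourceBdry]

theorem mem_targetBdry {x : Pos B n} : x ∈ targetBdry B n ↔ IsTargetBdry x := by
  simp [targetBdry]

theorem eq_zero_dim : ∀ {B : Bat} (x y : Pos B 0), B.dim ≤ 0 → x = y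
  | nil, here _, here _, _ => rfl
  | cons B T, _, _, h => by simp [dim] at h

/-- Positions of dimension n+1 with the same source are siblings in one parallel class, and distinct
siblings would be separated by positions of dimension n+2, which the height bound excludes. -/
theorem src_injective : ∀ {B : Bat} {n : ℕ}, B.dim ≤ n + 1 →
    Function.Injective (src : Pos B (n + 1) → Pos B n)
  | cons B T, n, h, inr x, inr y, e => by
      simp only [dim, sup_le_iff] at h
      exact congrArg inr (src_injective h.2 (by simpa using e))
  | cons B T, 0, h, inl x, inl y, e => by
      simp only [dim, sup_le_iff] at h
      exact congrArg inl (eq_zero_dim x y (by omega))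
  | cons B T, n + 1, h, inl x, inl y, e => by
      simp only [dim, sup_le_iff] at h
      exact congrArg inl (src_injective (by omega) (by simpa using e))
  | cons B T, 0, h, inl x, inr y, e => by simp at e
  | cons B T, 0, h, inr x, inl y, e => by simp at e
  | cons B T, n + 1, h, inl x, inr y, e => by simp at e
  | cons B T, n + 1, h, inr x, inl y, e => by simp at e

theorem tgt_ne_here (x : Pos B 1) : tgt x ≠ here _ := fun h => isSourceBdry_here _ ⟨x, h⟩

theorem tgt_injective : ∀ {B : Bat} {n : ℕ}, B.dim ≤ n + 1 →
    Function.Injective (tgt : Pos B (n + 1) → Pos B n)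
  | cons B T, n, h, inr x, inr y, e => by
      simp only [dim, sup_le_iff] at h
      exact congrArg inr (tgt_injective h.2 (by simpa using e))
  | cons B T, 0, h, inl x, inl y, e => by
      simp only [dim, sup_le_iff] at h
      exact congrArg inl (eq_zero_dim x y (by omega))
  | cons B T, n + 1, h, inl x, inl y, e => by
      simp only [dim, sup_le_iff] at h
      exact congrArg inl (tgt_injective (by omega) (by simpa using e))
  | cons B T, 0, h, inl x, inr y, e => (tgt_ne_here y (by simpa using e.symm)).elim
  | cons B T, 0, h, inr x, inl y, e => (tgt_ne_here x (by simpa using e)).elim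
  | cons B T, n + 1, h, inl x, inr y, e => by simp at e
  | cons B T, n + 1, h, inr x, inl y, e => by simp at e

/-! ### Splitting sums along the boundary positions -/

section Sums

variable {M : Type*} [AddCommMonoid M]

/-- A position that is not source boundary is a target, of a unique position by `tgt_injective`.
This is how the height bound on the tree of a coherence cell enters the Stokes formula. -/
theorem sum_sourceBdry_add (h : B.dim ≤ n + 1) (u : Pos B n → M) :
    ∑ x ∈ sourceBdry B n, u x + ∑ r : Pos B (n + 1), u (tgt r) = ∑ x, u x := by
  classical
  rw [← Finset.sum_filter_add_sum_filter_not Finset.univ IsSourceBdry u]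
  congr 1
  rw [← Finset.sum_image (f := u) (g := tgt) ((tgt_injective h).injOn)]
  congr 1
  ext x
  simp [IsSourceBdry]

theorem sum_targetBdry_add (h : B.dim ≤ n + 1) (u : Pos B n → M) :
    ∑ x ∈ targetBdry B n, u x + ∑ r : Pos B (n + 1), u (src r) = ∑ x, u x := by
  classical
  rw [← Finset.sum_filter_add_sum_filter_not Finset.univ IsTargetBdry u]
  congr 1
  rw [← Finset.sum_image (f := u) (g := src) ((src_injective h).injOn)]
  congr 1
  ext x
  simp [IsTargetBdry]

end Sums

/-! ### Testing multisets of positions against `after` -/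

section Multisets

open Classical

/-- Having one member per parallel class rules out repetitions, so the underlying set determines the
multiset. -/
theorem eq_sourceBdry {g : Multiset (Pos B n)} (hg : ∀ p, g.countP (B.pos.Par p) = 1)
    (h : ∀ x, x ∈ g ↔ IsSourceBdry x) : g = (sourceBdry B n).val := by
  rw [Multiset.Nodup.ext _ (Finset.nodup _)]
  · simpa [mem_sourceBdry] using h
  · refine Multiset.nodup_iff_count_le_one.2 fun x => ?_
    rw [← hg x, Multiset.count, Multiset.countP_eq_card_filter, Multiset.countP_eq_card_filter]
    exact Multiset.card_le_card
      (Multiset.monotone_filter_right g fun y e => e ▸ GlobSet.Par.refl _ _)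

theorem eq_targetBdry {g : Multiset (Pos B n)} (hg : ∀ p, g.countP (B.pos.Par p) = 1)
    (h : ∀ x, x ∈ g ↔ IsTargetBdry x) : g = (targetBdry B n).val := by
  rw [Multiset.Nodup.ext _ (Finset.nodup _)]
  · simpa [mem_targetBdry] using h
  · refine Multiset.nodup_iff_count_le_one.2 fun x => ?_
    rw [← hg x, Multiset.count, Multiset.countP_eq_card_filter, Multiset.countP_eq_card_filter]
    exact Multiset.card_le_card
      (Multiset.monotone_filter_right g fun y e => e ▸ GlobSet.Par.refl _ _)

theorem countP_eq_sum {α : Type*} (P : α → Prop) (g : Multiset α) :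
    g.countP P = (g.map fun x => if P x then 1 else 0).sum := by
  induction g using Multiset.induction with
  | empty => simp
  | cons a g ih => simp [Multiset.countP_cons, ih, add_comm]

theorem sum_after_tgt (g : Multiset (Pos B (n + 1))) (p : Pos B (n + 1)) :
    ((g.map tgt).map (after p)).sum =
      ((g.map src).map (after p)).sum + g.countP (B.pos.Par p) := by
  simp only [Multiset.map_map, Function.comp_def, after_tgt, Multiset.sum_map_add, countP_eq_sum]

theorem sum_after_sourceBdry (p : Pos B (n + 1)) :
    ((sourceBdry B n).val.map (after p)).sum = 0 :=
  Finset.sum_eq_zero fun _ hx => after_eq_zero_of_isSourceBdry p (mem_sourceBdry.1 hx)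

theorem sum_after_targetBdry (p : Pos B (n + 1)) :
    ((targetBdry B n).val.map (after p)).sum = 1 := by
  obtain ⟨y, h, hy⟩ := exists_par_isTargetBdry (tgt p)
  refine (Finset.sum_eq_single_of_mem y (mem_targetBdry.2 hy) fun x hx hxy => ?_).trans ?_
  · rw [after_of_isTargetBdry p (mem_targetBdry.1 hx), if_neg]
    exact fun e => hxy ((mem_targetBdry.1 hx).eq_of_par hy (e.symm.trans h))
  · rw [after_of_isTargetBdry p hy, if_pos h]

/-- Sum `after p` over both sides of `h`: the source boundary contributes 0, the target boundary
contributes 1, and the sums over `g.map tgt` and `g.map src` differ by the count. -/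
theorem countP_par_eq_one {g : Multiset (Pos B (n + 1))}
    (h : (sourceBdry B n).val + g.map tgt = (targetBdry B n).val + g.map src)
    (p : Pos B (n + 1)) : g.countP (B.pos.Par p) = 1 := by
  have := congrArg (fun m => (m.map (after p)).sum) h
  simp only [Multiset.map_add, Multiset.sum_add, sum_after_tgt, sum_after_sourceBdry,
    sum_after_targetBdry] at this
  omega

theorem sum_after_le (a : Multiset (Pos B n)) (r : Pos B (n + 1)) :
    (a.map (after r)).sum ≤ a.countP (B.pos.Par (tgt r)) := by
  rw [countP_eq_sum]
  exact Multiset.sum_map_le_sum_map _ _ fun x _ => after_le r x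

theorem sum_after_lt {a : Multiset (Pos B n)} {r : Pos B (n + 1)} (h : src r ∈ a) :
    (a.map (after r)).sum < a.countP (B.pos.Par (tgt r)) := by
  obtain ⟨a, rfl⟩ := Multiset.exists_cons_of_mem h
  rw [Multiset.countP_cons, if_pos (par_src_tgt r).symm, Multiset.map_cons, Multiset.sum_cons,
    (after_tgt_self r).2]
  have := sum_after_le a r
  omega

theorem sum_after_pos {a : Multiset (Pos B n)} {r : Pos B (n + 1)} (h : tgt r ∈ a) :
    0 < (a.map (after r)).sum := by
  obtain ⟨a, rfl⟩ := Multiset.exists_cons_of_mem h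
  rw [Multiset.map_cons, Multiset.sum_cons, (after_tgt_self r).1]
  omega

theorem mem_iff_bdry {a b : Multiset (Pos B n)} {g : Multiset (Pos B (n + 1))}
    (ha : ∀ p, a.countP (B.pos.Par p) = 1) (hb : ∀ p, b.countP (B.pos.Par p) = 1)
    (hg : ∀ p, 0 < g.countP (B.pos.Par p)) (h : a + g.map tgt = b + g.map src) :
    (∀ x, x ∈ a ↔ IsSourceBdry x) ∧ ∀ x, x ∈ b ↔ IsTargetBdry x := by
  -- Summing `after r` over `h` gives: sum over `a`, plus the count of the class of `r` in `g`,
  -- equals the sum over `b`. The count is at least 1 and the sum over `b` at most 1, so the sums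
  -- over `a` and `b` must be 0 and 1. A member `tgt r` of `a` or `src r` of `b` would violate this.
  have key (r : Pos B (n + 1)) : tgt r ∉ a ∧ src r ∉ b := by
    have e := congrArg (fun m => (m.map (after r)).sum) h
    simp only [Multiset.map_add, Multiset.sum_add, sum_after_tgt] at e
    have h₁ := hg r
    have h₂ := sum_after_le b r
    have h₃ := hb (tgt r)
    refine ⟨fun h' => ?_, fun h' => ?_⟩
    · have := sum_after_pos h'
      omega
    · have := sum_after_lt h'
      omega
  have ha' : ∀ x ∈ a, IsSourceBdry x := by
    rintro _ hx ⟨r, rfl⟩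
    exact (key r).1 hx
  have hb' : ∀ x ∈ b, IsTargetBdry x := by
    rintro _ hx ⟨r, rfl⟩
    exact (key r).2 hx
  refine ⟨fun x => ⟨ha' x, fun hx => ?_⟩, fun x => ⟨hb' x, fun hx => ?_⟩⟩
  -- The class of `x` has a member in `a`; it is source boundary, hence is `x` by uniqueness.
  · obtain ⟨y, hy, hy'⟩ := Multiset.countP_pos.1 ((ha x).symm ▸ Nat.one_pos)
    exact hx.eq_of_par (ha' y hy) hy' ▸ hy
  · obtain ⟨y, hy, hy'⟩ := Multiset.countP_pos.1 ((hb x).symm ▸ Nat.one_pos)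
    exact hx.eq_of_par (hb' y hy) hy' ▸ hy

end Multisets

end Pos

open Pos

/-! ### The inclusions of the boundary -/

theorem sIncl_injective : ∀ (k : ℕ) (B : Bat) {n : ℕ},
    Function.Injective (sIncl k B : Pos (bdry k B) n → Pos B n)
  | 0, nil, _, _, _, h => h
  | _ + 1, nil, _, _, _, h => h
  | 0, cons _ _, _, here _, here _, _ => rfl
  | _ + 1, cons _ _, _, here _, here _, _ => rfl
  | k + 1, cons B _, _, inl _, inl _, h => congrArg inl (sIncl_injective k B (inl.inj h))
  | k + 1, cons _ T, _, inr _, inr _, h => congrArg inr (sIncl_injective (k + 1) T (inr.inj h))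

theorem tIncl_injective : ∀ (k : ℕ) (B : Bat) {n : ℕ},
    Function.Injective (tIncl k B : Pos (bdry k B) n → Pos B n)
  | 0, nil, _, _, _, h => h
  | _ + 1, nil, _, _, _, h => h
  | 0, cons _ _, _, here _, here _, _ => rfl
  | _ + 1, cons _ _, _, here _, here _, _ => rfl
  | k + 1, cons B _, _, inl _, inl _, h => congrArg inl (tIncl_injective k B (inl.inj h))
  | k + 1, cons _ T, _, inr _, inr _, h => congrArg inr (tIncl_injective (k + 1) T (inr.inj h))

theorem sIncl_surjective : ∀ (k : ℕ) (B : Bat) {n : ℕ}, n < k →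
    Function.Surjective (sIncl k B : Pos (bdry k B) n → Pos B n)
  | _ + 1, nil, _, _, x => ⟨x, rfl⟩
  | _ + 1, cons _ _, _, _, here _ => ⟨here _, rfl⟩
  | k + 1, cons B _, _ + 1, h, inl x =>
      let ⟨y, hy⟩ := sIncl_surjective k B (by omega) x
      ⟨inl y, congrArg inl hy⟩
  | k + 1, cons _ T, _, h, inr x =>
      let ⟨y, hy⟩ := sIncl_surjective (k + 1) T h x
      ⟨inr y, congrArg inr hy⟩

theorem tIncl_surjective : ∀ (k : ℕ) (B : Bat) {n : ℕ}, n < k →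
    Function.Surjective (tIncl k B : Pos (bdry k B) n → Pos B n)
  | _ + 1, nil, _, _, x => ⟨x, rfl⟩
  | _ + 1, cons _ _, _, _, here _ => ⟨here _, rfl⟩
  | k + 1, cons B _, _ + 1, h, inl x =>
      let ⟨y, hy⟩ := tIncl_surjective k B (by omega) x
      ⟨inl y, congrArg inl hy⟩
  | k + 1, cons _ T, _, h, inr x =>
      let ⟨y, hy⟩ := tIncl_surjective (k + 1) T h x
      ⟨inr y, congrArg inr hy⟩

theorem isSourceBdry_sIncl_self : ∀ (k : ℕ) (B : Bat) (x : Pos (bdry k B) k),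
    IsSourceBdry (sIncl k B x)
  | 0, nil, here _ => isSourceBdry_here _
  | 0, cons _ _, here _ => isSourceBdry_here _
  | k + 1, cons B _, inl x => isSourceBdry_inl.2 (isSourceBdry_sIncl_self k B x)
  | k + 1, cons _ T, inr x => isSourceBdry_inr.2 (isSourceBdry_sIncl_self (k + 1) T x)

theorem isTargetBdry_tIncl_self : ∀ (k : ℕ) (B : Bat) (x : Pos (bdry k B) k),
    IsTargetBdry (tIncl k B x)
  | 0, nil, here _ => isTargetBdry_here_nil
  | 0, cons B T, here _ => isTargetBdry_inr.2 <| by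
      have := isTargetBdry_tIncl_self 0 T
      cases T <;> exact this _
  | k + 1, cons B _, inl x => isTargetBdry_inl.2 (isTargetBdry_tIncl_self k B x)
  | k + 1, cons _ T, inr x => isTargetBdry_inr.2 (isTargetBdry_tIncl_self (k + 1) T x)

/-- Truncation at height `k` collapses each parallel class of k-positions to one leaf, so the
inclusion picks a representative of every class. Together with uniqueness of boundary members this
determines its range in dimension `k`. -/
theorem exists_par_sIncl : ∀ (k : ℕ) (B : Bat) (x : Pos B k),
    ∃ y, B.pos.Par (sIncl k B y) x
  | 0, _, _ => ⟨here _, trivial⟩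
  | k + 1, cons B _, inl x =>
      let ⟨y, hy⟩ := exists_par_sIncl k B x
      ⟨inl y, par_inl.2 hy⟩
  | k + 1, cons _ T, inr x =>
      let ⟨y, hy⟩ := exists_par_sIncl (k + 1) T x
      ⟨inr y, par_inr.2 hy⟩

theorem exists_par_tIncl : ∀ (k : ℕ) (B : Bat) (x : Pos B k),
    ∃ y, B.pos.Par (tIncl k B y) x
  | 0, _, _ => ⟨here _, trivial⟩
  | k + 1, cons B _, inl x =>
      let ⟨y, hy⟩ := exists_par_tIncl k B x
      ⟨inl y, par_inl.2 hy⟩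
  | k + 1, cons _ T, inr x =>
      let ⟨y, hy⟩ := exists_par_tIncl (k + 1) T x
      ⟨inr y, par_inr.2 hy⟩

theorem mem_range_sIncl {k : ℕ} {B : Bat} {x : Pos B k} :
    (∃ y, sIncl k B y = x) ↔ IsSourceBdry x := by
  refine ⟨fun ⟨y, h⟩ => h ▸ isSourceBdry_sIncl_self k B y, fun h => ?_⟩
  obtain ⟨y, hy⟩ := exists_par_sIncl k B x
  exact ⟨y, (isSourceBdry_sIncl_self k B y).eq_of_par h hy⟩

theorem mem_range_tIncl {k : ℕ} {B : Bat} {x : Pos B k} :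
    (∃ y, tIncl k B y = x) ↔ IsTargetBdry x := by
  refine ⟨fun ⟨y, h⟩ => h ▸ isTargetBdry_tIncl_self k B y, fun h => ?_⟩
  obtain ⟨y, hy⟩ := exists_par_tIncl k B x
  exact ⟨y, (isTargetBdry_tIncl_self k B y).eq_of_par h hy⟩

theorem exists_par_sIncl_of_le {k n : ℕ} (h : n ≤ k) (B : Bat) (x : Pos B n) :
    ∃ y, B.pos.Par (sIncl k B y) x := by
  obtain rfl | h := h.eq_or_lt
  · exact exists_par_sIncl n B x
  · obtain ⟨y, rfl⟩ := sIncl_surjective k B h x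
    exact ⟨y, GlobSet.Par.refl _ _⟩

/-- If `q` witnesses that the image of `x` is a target, `q` can be replaced by a parallel position
in the range of the inclusion, since parallel positions share their target. -/
theorem isSourceBdry_sIncl {k n : ℕ} (h : n < k) {B : Bat} (x : Pos (bdry k B) n) :
    IsSourceBdry (sIncl k B x) ↔ IsSourceBdry x := by
  refine not_congr ⟨fun ⟨q, hq⟩ => ?_, fun ⟨q, hq⟩ => ⟨sIncl k B q, ?_⟩⟩
  · obtain ⟨y, hy⟩ := exists_par_sIncl_of_le h B q
    exact ⟨y, sIncl_injective k B ((sIncl_tgt k B y).trans (hy.2.trans hq))⟩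
  · rw [← sIncl_tgt, hq]

theorem isTargetBdry_sIncl {k n : ℕ} (h : n < k) {B : Bat} (x : Pos (bdry k B) n) :
    IsTargetBdry (sIncl k B x) ↔ IsTargetBdry x := by
  refine not_congr ⟨fun ⟨q, hq⟩ => ?_, fun ⟨q, hq⟩ => ⟨sIncl k B q, ?_⟩⟩
  · obtain ⟨y, hy⟩ := exists_par_sIncl_of_le h B q
    exact ⟨y, sIncl_injective k B ((sIncl_src k B y).trans (hy.1.trans hq))⟩
  · rw [← sIncl_src, hq]

end Bat

/-! ### Supports, multiplicities and liftings -/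

namespace Level

open Bat Bat.Pos

/-- Data accompanying a stage of the recursion, describing the supports of homomorphisms and of
cells of free computads, together with the multiplicities of the top-dimensional generators in cells
of free computads. -/
structure Supports {n : ℕ} (L : Level n) where
  /-- the support of the image of a generator -/
  genSupp : ∀ {D C}, L.Hom D C → L.Gen D → Set (L.Gen C)
  /-- the action of a morphism of globular sets on generators -/
  genMap : ∀ {X Y : GlobSet}, GlobSet.Hom X Y → L.Gen (L.free X) → L.Gen (L.free Y)
  /-- an `n`-cell of a globular set, seen as a generator -/
  topGen : ∀ {X : GlobSet}, X.cell n → L.Gen (L.free X)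
  /-- the generators of dimension less than `n` -/
  low : ∀ X : GlobSet, Set (L.Gen (L.free X))
  /-- generators are related when they are equal or of dimension `n` and parallel -/
  rel : ∀ X : GlobSet, L.Gen (L.free X) → L.Gen (L.free X) → Prop
  /-- the generators of dimension `n` in a cell, with multiplicities -/
  gens : ∀ {X : GlobSet}, L.Cell (L.free X) → Multiset (X.cell n)
  pr₁_map : ∀ {D C} (σ : L.Hom D C) (A : L.Sph D),
    L.pr₁ (L.sphMap σ A) = L.cellMap σ (L.pr₁ A)
  pr₂_map : ∀ {D C} (σ : L.Hom D C) (A : L.Sph D),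
    L.pr₂ (L.sphMap σ A) = L.cellMap σ (L.pr₂ A)
  pr₁_parSph : ∀ (X : GlobSet) (x y : X.cell n) (h), L.pr₁ (L.parSph X x y h) = L.genCell x
  pr₂_parSph : ∀ (X : GlobSet) (x y : X.cell n) (h), L.pr₂ (L.parSph X x y h) = L.genCell y
  homSupp_eq : ∀ {D C} (σ : L.Hom D C), L.homSupp σ = ⋃ g, genSupp σ g
  homSupp_id : ∀ C, L.homSupp (L.id C) = Set.univ
  homSupp_comp : ∀ {E D C} (σ : L.Hom D C) (τ : L.Hom E D),
    L.homSupp (L.comp σ τ) = ⋃ g ∈ L.homSupp τ, genSupp σ g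
  supp_map : ∀ {D C} (σ : L.Hom D C) (c : L.Cell D),
    L.supp (L.cellMap σ c) = ⋃ g ∈ L.supp c, genSupp σ g
  homSupp_comp_freeMap : ∀ {X Y} (f : GlobSet.Hom X Y) {D} (τ : L.Hom D (L.free X)),
    L.homSupp (L.comp (L.freeMap f) τ) = genMap f '' L.homSupp τ
  supp_freeMap : ∀ {X Y} (f : GlobSet.Hom X Y) (c : L.Cell (L.free X)),
    L.supp (L.cellMap (L.freeMap f) c) = genMap f '' L.supp c
  genMap_injective : ∀ {X Y} (f : GlobSet.Hom X Y),
    (∀ k, Function.Injective (f.app (n := k))) → Function.Injective (genMap f)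
  genMap_surjective : ∀ {X Y} (f : GlobSet.Hom X Y),
    (∀ k ≤ n, Function.Surjective (f.app (n := k))) → Function.Surjective (genMap f)
  genMap_topGen : ∀ {X Y} (f : GlobSet.Hom X Y) (x : X.cell n),
    genMap f (topGen x) = topGen (f.app x)
  mem_low_genMap : ∀ {X Y} (f : GlobSet.Hom X Y),
    (∀ k < n, Function.Surjective (f.app (n := k))) → genMap f '' low X = low Y
  low_or_top : ∀ {X} (g : L.Gen (L.free X)), g ∈ low X ∨ ∃ x, topGen x = g
  topGen_mem_supp : ∀ {X : GlobSet} (x : X.cell n), topGen x ∈ L.supp (L.genCell x)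
  supp_genCell : ∀ {X : GlobSet} (x : X.cell n) {g}, g ∈ L.supp (L.genCell x) →
    g ∈ low X ∨ g = topGen x
  rel_refl : ∀ {X} (g : L.Gen (L.free X)), rel X g g
  rel_trans : ∀ {X} {g h k : L.Gen (L.free X)}, rel X g h → rel X h k → rel X g k
  rel_genCell : ∀ {X : GlobSet} {x y : X.cell n} {g}, X.Par x y → g ∈ L.supp (L.genCell y) →
    ∃ g' ∈ L.supp (L.genCell x), rel X g g'
  full_supp₁ : ∀ {B : Bat} {S}, L.Full B S →
    L.supp (L.pr₁ S) = low B.pos ∪ topGen '' {x : B.Pos n | x.IsSourceBdry}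
  full_supp₂ : ∀ {B : Bat} {S}, L.Full B S →
    L.supp (L.pr₂ S) = low B.pos ∪ topGen '' {x : B.Pos n | x.IsTargetBdry}
  gens_genCell : ∀ {X : GlobSet} (x : X.cell n), gens (L.genCell x) = {x}
  gens_map : ∀ {X Y : GlobSet} (τ : L.Hom (L.free X) (L.free Y)) (c : L.Cell (L.free X)),
    gens (L.cellMap τ c) = (gens c).bind fun x => gens (L.cellMap τ (L.genCell x))
  full_gens₁ : ∀ {B : Bat} {S}, L.Full B S → gens (L.pr₁ S) = (sourceBdry B n).val
  full_gens₂ : ∀ {B : Bat} {S}, L.Full B S → gens (L.pr₂ S) = (targetBdry B n).val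
  -- The form of the hard implication that survives the recursion: `m` stands in for the generators
  -- of a filler of `S`, of which only the Stokes formula and the classes met are remembered.
  full_of_gens : ∀ {B : Bat} {S : L.Sph (L.free B.pos)} (m : Multiset (B.Pos (n + 1))),
    gens (L.pr₁ S) + m.map Pos.tgt = gens (L.pr₂ S) + m.map Pos.src →
    (∀ p, ∃ q ∈ m, B.pos.Par p q) → (∀ g, ∃ g' ∈ L.supp (L.pr₁ S), rel B.pos g g') → L.Full B S
  sphMap_freeMap_injective : ∀ {X Y} (f : GlobSet.Hom X Y),
    (∀ k, Function.Injective (f.app (n := k))) → Function.Injective (L.sphMap (L.freeMap f))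
  comp_freeMap_injective : ∀ {X Y} (f : GlobSet.Hom X Y),
    (∀ k, Function.Injective (f.app (n := k))) → ∀ {D} {τ τ' : L.Hom D (L.free X)},
    L.comp (L.freeMap f) τ = L.comp (L.freeMap f) τ' → τ = τ'
  exists_comp_freeMap : ∀ {X Y} (f : GlobSet.Hom X Y),
    (∀ k, Function.Injective (f.app (n := k))) → ∀ {D} (τ : L.Hom D (L.free Y)),
    L.homSupp τ ⊆ Set.range (genMap f) → ∃ τ', L.comp (L.freeMap f) τ' = τ
  exists_cellMap_freeMap : ∀ {X Y} (f : GlobSet.Hom X Y),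
    (∀ k, Function.Injective (f.app (n := k))) → ∀ c : L.Cell (L.free Y),
    L.supp c ⊆ Set.range (genMap f) → ∃ c', L.cellMap (L.freeMap f) c' = c

theorem homSupp_comp_base {E D C : Type} (σ : D → C) (τ : E → D) :
    ⋃ v, {σ (τ v)} = ⋃ g ∈ ⋃ v, {τ v}, ({σ g} : Set C) := by
  simp

theorem homSupp_image_base {E D C : Type} (σ : D → C) (τ : E → D) :
    ⋃ v, ({σ (τ v)} : Set C) = σ '' ⋃ v, {τ v} := by
  ext
  simp

theorem supp_map_base {D C : Type} (σ : D → C) (c : D) :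
    ({σ c} : Set C) = ⋃ g ∈ ({c} : Set D), {σ g} := by
  simp

open Classical in
/-- The data at stage `0`. -/
noncomputable def Supports.base : Supports Level.base where
  genSupp {D C} (σ : D → C) g := {σ g}
  genMap f x := f.app x
  topGen x := x
  low _ := ∅
  rel _ _ _ := True
  gens {X} x := ({x} : Multiset (X.cell 0))
  pr₁_map _ _ := rfl
  pr₂_map _ _ := rfl
  pr₁_parSph _ _ _ _ := rfl
  pr₂_parSph _ _ _ _ := rfl
  homSupp_eq _ := rfl
  homSupp_id C := Set.iUnion_of_singleton C
  homSupp_comp {E D C} σ τ := homSupp_comp_base (E := E) (D := D) (C := C) σ τ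
  supp_map {D C} σ c := supp_map_base (D := D) (C := C) σ c
  homSupp_comp_freeMap {X Y} f D τ := homSupp_image_base (E := D) (D := X.cell 0) (C := Y.cell 0) _ τ
  supp_freeMap {X Y} f c :=
    (Set.image_singleton (α := X.cell 0) (β := Y.cell 0) (a := c)).symm
  genMap_injective f hf := hf 0
  genMap_surjective f hf := hf 0 le_rfl
  genMap_topGen _ _ := rfl
  mem_low_genMap _ _ := Set.image_empty _
  low_or_top g := Or.inr ⟨g, rfl⟩
  topGen_mem_supp x := rfl
  supp_genCell x g hg := Or.inr hg
  rel_refl _ := trivial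
  rel_trans _ _ := trivial
  rel_genCell {_ x _ _} _ _ := ⟨x, rfl, trivial⟩
  full_supp₁ {B S} h := by
    refine Eq.trans (b := ({S.1} : Set (B.Pos 0))) rfl (Eq.trans ?_ (Set.empty_union _).symm)
    ext x
    exact ⟨fun e => ⟨_, h.1, (Set.mem_singleton_iff.1 e).symm⟩, fun ⟨y, hy, e⟩ =>
      e.symm.trans (IsSourceBdry.eq_of_par hy h.1 trivial)⟩
  full_supp₂ {B S} h := by
    refine Eq.trans (b := ({S.2} : Set (B.Pos 0))) rfl (Eq.trans ?_ (Set.empty_union _).symm)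
    ext x
    exact ⟨fun e => ⟨_, h.2, (Set.mem_singleton_iff.1 e).symm⟩, fun ⟨y, hy, e⟩ =>
      e.symm.trans (IsTargetBdry.eq_of_par hy h.2 trivial)⟩
  gens_genCell _ := rfl
  gens_map τ c := (Multiset.singleton_bind _ _).symm
  full_gens₁ {B S} h := eq_sourceBdry
    (fun p => (Multiset.countP_cons_of_pos _ trivial).trans (by simp))
    fun x => Multiset.mem_singleton.trans
      ⟨fun e => e ▸ h.1, fun hx => IsSourceBdry.eq_of_par hx h.1 trivial⟩
  full_gens₂ {B S} h := eq_targetBdry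
    (fun p => (Multiset.countP_cons_of_pos _ trivial).trans (by simp))
    fun x => Multiset.mem_singleton.trans
      ⟨fun e => e ▸ h.2, fun hx => IsTargetBdry.eq_of_par hx h.2 trivial⟩
  full_of_gens {B S} m h hm _ := by
    have := mem_iff_bdry (a := {S.1}) (b := {S.2})
      (fun p => (Multiset.countP_cons_of_pos _ trivial).trans (by simp))
      (fun p => (Multiset.countP_cons_of_pos _ trivial).trans (by simp))
      (fun p => Multiset.countP_pos.2 (hm p)) h
    exact ⟨(this.1 _).1 (Multiset.mem_singleton_self _),
      (this.2 _).1 (Multiset.mem_singleton_self _)⟩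
  sphMap_freeMap_injective f hf A A' h :=
    Prod.ext (hf 0 (congrArg Prod.fst h)) (hf 0 (congrArg Prod.snd h))
  comp_freeMap_injective f hf D τ τ' h := funext fun x => hf 0 (congrFun h x)
  exists_comp_freeMap f hf D τ h := by
    have : ∀ x : D, ∃ y, f.app y = τ x := fun x => h (Set.mem_iUnion.2 ⟨x, rfl⟩)
    choose τ' hτ' using this
    exact ⟨τ', funext hτ'⟩
  exists_cellMap_freeMap f hf c h := h (Set.mem_singleton _)


section

variable {n : ℕ} {L : Level n}

/-! ### Supports and multiplicities one dimension up -/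

namespace NCell

theorem supp_retype {C : L.NComp} {A A' : L.Sph C.base} (e : A = A') (c : L.NCell C A) :
    (c.retype e).supp = c.supp := by
  subst e; rw [retype_rfl]

/-- The multiset of `(n+1)`-dimensional generators in an `(n+1)`-cell. -/
noncomputable def gens {C : L.NComp} {A : L.Sph C.base} : L.NCell C A → Multiset C.V
  | var v _ => {v}
  | coh _ _ _ _ _ τV _ => ∑ p, gens (τV p)

theorem gens_retype {C : L.NComp} {A A' : L.Sph C.base} (e : A = A') (c : L.NCell C A) :
    (c.retype e).gens = c.gens := by
  subst e; rw [retype_rfl]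

theorem mem_gens {C : L.NComp} {A : L.Sph C.base} (c : L.NCell C A) (v : C.V) :
    v ∈ c.gens ↔ v ∈ c.topSupp := by
  induction c with
  | var w h => simp [gens, topSupp]
  | coh B hB S hS τ τV h ih => simp [gens, topSupp, Multiset.mem_sum, ih]

theorem inr_mem_supp {C : L.NComp} {A : L.Sph C.base} (c : L.NCell C A) (v : C.V) :
    Sum.inr v ∈ c.supp ↔ v ∈ c.topSupp := by
  induction c with
  | var w h => simp [supp, topSupp]
  | coh B hB S hS τ τV h ih => simp [supp, topSupp, ih]

theorem gens_map {D C : L.NComp} (σ : L.NHom D C) {A : L.Sph D.base}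
    (c : L.NCell D A) {A' : L.Sph C.base} (h : L.sphMap σ.base A = A') :
    (c.map σ h).gens = c.gens.bind fun v => (σ.onV v).gens := by
  induction c generalizing A' with
  | var v e => exact (gens_retype _ _).trans (Multiset.singleton_bind _ _).symm
  | coh B hB S hS τ τV e ih =>
    let F : Multiset D.V →+ Multiset C.V :=
      { toFun s := s.bind fun v => (σ.onV v).gens
        map_zero' := Multiset.zero_bind _
        map_add' s t := Multiset.add_bind s t _ }
    exact (Finset.sum_congr rfl fun p _ => ih p _).trans (map_sum F _ _).symm

end NCell

namespace Supports

/-- The boundary of a coherence cell is the image of a sphere under `τ`, so its support is made of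
supports of values of `τ`. -/
theorem image_supp_pr₁_subset (E : Supports L) {C : L.NComp} {A : L.Sph C.base}
    (c : L.NCell C A) :
    Sum.inl '' L.supp (L.pr₁ A) ⊆ c.supp := by
  cases c with
  | var v h =>
    subst h
    exact Set.subset_union_of_subset_right (Set.image_mono Set.subset_union_left) _
  | coh B hB S hS τ τV h =>
    subst h
    refine Set.subset_union_of_subset_left (Set.image_mono ?_) _
    rw [E.pr₁_map, E.supp_map, E.homSupp_eq]
    exact Set.iUnion₂_subset fun g _ => Set.subset_iUnion _ g

theorem image_supp_pr₂_subset (E : Supports L) {C : L.NComp} {A : L.Sph C.base}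
    (c : L.NCell C A) :
    Sum.inl '' L.supp (L.pr₂ A) ⊆ c.supp := by
  cases c with
  | var v h =>
    subst h
    exact Set.subset_union_of_subset_right (Set.image_mono Set.subset_union_right) _
  | coh B hB S hS τ τV h =>
    subst h
    refine Set.subset_union_of_subset_left (Set.image_mono ?_) _
    rw [E.pr₂_map, E.supp_map, E.homSupp_eq]
    exact Set.iUnion₂_subset fun g _ => Set.subset_iUnion _ g

/-- The support of the image of a generator, at the next stage. -/
def nextGenSupp (E : Supports L) {D C : L.NComp} (σ : L.NHom D C) :
    L.Gen D.base ⊕ D.V → Set (L.Gen C.base ⊕ C.V)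
  | Sum.inl g => Sum.inl '' E.genSupp σ.base g
  | Sum.inr v => (σ.onV v).supp

theorem supp_map_next (E : Supports L) {D C : L.NComp} (σ : L.NHom D C) {A : L.Sph D.base}
    (c : L.NCell D A) {A' : L.Sph C.base} (h : L.sphMap σ.base A = A') :
    (c.map σ h).supp = ⋃ g ∈ c.supp, E.nextGenSupp σ g := by
  induction c generalizing A' with
  | var v e =>
    refine (NCell.supp_retype _ _).trans ?_
    rw [NCell.supp, Set.biUnion_union, Set.biUnion_singleton, Set.biUnion_image,
      Set.biUnion_union]
    -- The boundary of `v` adds nothing new: the support of the image of `v` already contains that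
    -- of its own boundary.
    refine (Set.union_eq_left.2 (Set.union_subset ?_ ?_)).symm
    · refine subset_trans ?_ (E.image_supp_pr₁_subset (σ.onV v))
      rw [E.pr₁_map, E.supp_map, Set.image_iUnion₂]
      rfl
    · refine subset_trans ?_ (E.image_supp_pr₂_subset (σ.onV v))
      rw [E.pr₂_map, E.supp_map, Set.image_iUnion₂]
      rfl
  | coh B hB S hS τ τV e ih =>
    rw [NCell.map, NCell.supp, NCell.supp, Set.biUnion_union, E.homSupp_comp, Set.biUnion_image,
      Set.image_iUnion₂, Set.biUnion_iUnion]
    exact congrArg₂ _ rfl (Set.iUnion_congr fun p => ih p _)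

theorem image_sumMap_singleton_union {α β γ δ : Type*} (f : α → β) (g : γ → δ) (v : γ)
    (s t : Set α) : Sum.map f g '' ({Sum.inr v} ∪ Sum.inl '' (s ∪ t)) =
      {Sum.inr (g v)} ∪ Sum.inl '' (f '' s ∪ f '' t) := by
  simp [Set.image_insert_eq, Set.image_image, Set.image_union]

/-- The action of a morphism of globular sets on generators, at the next stage. -/
def nextGenMap (E : Supports L) {X Y : GlobSet} (f : GlobSet.Hom X Y) :
    L.Gen (L.free X) ⊕ X.cell (n + 1) → L.Gen (L.free Y) ⊕ Y.cell (n + 1) :=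
  Sum.map (E.genMap f) f.app

theorem supp_freeMap_next (E : Supports L) {X Y : GlobSet} (f : GlobSet.Hom X Y)
    {A : L.Sph (L.nfree X).base}
    (c : L.NCell (L.nfree X) A) {A' : L.Sph (L.free Y)} (h : L.sphMap (L.freeMap f) A = A') :
    (c.map (nfreeMap f) h).supp = E.nextGenMap f '' c.supp := by
  induction c generalizing A' with
  | var v e =>
    have hφ : (L.nfree Y).φ (f.app v) = L.sphMap (L.freeMap f) ((L.nfree X).φ v) := by
      rw [L.sphMap_parSph]
      simp only [nfree, f.app_src, f.app_tgt]
    refine (NCell.supp_retype _ _).trans ?_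
    rw [NCell.supp, NCell.supp, hφ, E.pr₁_map, E.pr₂_map, E.supp_freeMap, E.supp_freeMap]
    exact (image_sumMap_singleton_union (E.genMap f) (f.app (n := n + 1)) v _ _).symm
  | coh B hB S hS τ τV e ih =>
    rw [NCell.map, NCell.supp, NCell.supp, E.homSupp_comp_freeMap, Set.image_union,
      Set.image_iUnion, Set.image_image, Set.image_image]
    exact congrArg₂ _ rfl (Set.iUnion_congr fun p => ih p _)

/-- For a coherence cell, the formulas for the cells `τV p` are added up over all `p`. With `u x`
the generators in `τ x`, the contributions of interior n-positions cancel and those of the target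
and source boundary remain, which are the generators of the two ends because `S` is full. -/
theorem stokes (E : Supports L) {X : GlobSet} {A : L.Sph (L.nfree X).base}
    (c : L.NCell (L.nfree X) A) :
    E.gens (L.pr₁ A) + c.gens.map X.tgt = E.gens (L.pr₂ A) + c.gens.map X.src := by
  induction c with
  | var v h =>
    subst h
    rw [E.pr₁_parSph, E.pr₂_parSph, E.gens_genCell, E.gens_genCell, NCell.gens,
      Multiset.map_singleton, Multiset.map_singleton, add_comm]
  | coh B hB S hS τ τV h ih =>
    subst h
    let u (x : B.Pos n) : Multiset (X.cell n) := E.gens (L.cellMap τ (L.genCell x))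
    have h₁ : E.gens (L.pr₁ (L.sphMap τ S)) = ∑ x ∈ sourceBdry B n, u x := by
      rw [E.pr₁_map, E.gens_map, E.full_gens₁ hS]; rfl
    have h₂ : E.gens (L.pr₂ (L.sphMap τ S)) = ∑ x ∈ targetBdry B n, u x := by
      rw [E.pr₂_map, E.gens_map, E.full_gens₂ hS]; rfl
    have ih' (p : B.Pos (n + 1)) : u (Pos.src p) + (τV p).gens.map X.tgt =
        u (Pos.tgt p) + (τV p).gens.map X.src := by
      have := ih p
      rwa [E.pr₁_map, E.pr₂_map, E.pr₁_parSph, E.pr₂_parSph] at this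
    have hsum := Finset.sum_congr rfl fun p (_ : p ∈ Finset.univ) => ih' p
    rw [Finset.sum_add_distrib, Finset.sum_add_distrib] at hsum
    have ht : (∑ p, (τV p).gens).map X.tgt = ∑ p, (τV p).gens.map X.tgt :=
      map_sum (Multiset.mapAddMonoidHom X.tgt) _ _
    have hs : (∑ p, (τV p).gens).map X.src = ∑ p, (τV p).gens.map X.src :=
      map_sum (Multiset.mapAddMonoidHom X.src) _ _
    have hP := (sum_sourceBdry_add hB u).trans (sum_targetBdry_add hB u).symm
    rw [h₁, h₂, NCell.gens, ht, hs]
    -- In the absence of negatives, the sums of `u` over all sources and all targets are added to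
    -- both sides and regrouped.
    refine add_left_cancel (a := ∑ p : B.Pos (n + 1), u (Pos.src p) +
      ∑ p : B.Pos (n + 1), u (Pos.tgt p)) ?_
    calc _ = (∑ x ∈ sourceBdry B n, u x + ∑ p : B.Pos (n + 1), u (Pos.tgt p)) +
          (∑ p : B.Pos (n + 1), u (Pos.src p) + ∑ p, (τV p).gens.map X.tgt) := by abel
      _ = (∑ x ∈ targetBdry B n, u x + ∑ p : B.Pos (n + 1), u (Pos.src p)) +
          (∑ p : B.Pos (n + 1), u (Pos.tgt p) + ∑ p, (τV p).gens.map X.src) := by rw [hP, hsum]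
      _ = _ := by abel

theorem countP_gens (E : Supports L) {B : Bat} {A : L.Sph (L.nfree B.pos).base} (hA : L.Full B A)
    (c : L.NCell (L.nfree B.pos) A) (p : B.Pos (n + 1)) :
    open Classical in c.gens.countP (B.pos.Par p) = 1 := by
  refine countP_par_eq_one ?_ p
  rw [← E.full_gens₁ hA, ← E.full_gens₂ hA]
  exact E.stokes c

theorem topGen_tgt_mem (E : Supports L) {X : GlobSet} {A : L.Sph (L.nfree X).base}
    (c : L.NCell (L.nfree X) A)
    {x : X.cell (n + 1)} (h : x ∈ c.topSupp) : Sum.inl (E.topGen (X.tgt x)) ∈ c.supp := by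
  induction c with
  | var v e =>
    obtain rfl : x = v := h
    refine Or.inr ⟨_, Or.inr ?_, rfl⟩
    rw [E.pr₂_parSph]
    exact E.topGen_mem_supp _
  | coh B hB S hS τ τV e ih =>
    obtain ⟨p, hp⟩ := Set.mem_iUnion.1 h
    exact Or.inr (Set.mem_iUnion.2 ⟨p, ih p hp⟩)

/-- A cell with full boundary whose top-dimensional support meets every class of parallel positions
contains all generators of lower dimension. -/
theorem inl_mem_supp (E : Supports L) {B : Bat} {A : L.Sph (L.nfree B.pos).base} (hA : L.Full B A)
    (c : L.NCell (L.nfree B.pos) A) (hc : ∀ p, ∃ q ∈ c.topSupp, B.pos.Par p q)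
    (g : L.Gen (L.free B.pos)) : Sum.inl g ∈ c.supp := by
  have h₁ := E.image_supp_pr₁_subset c
  have h₂ := E.image_supp_pr₂_subset c
  rw [E.full_supp₁ hA] at h₁
  rw [E.full_supp₂ hA] at h₂
  obtain h | ⟨x, rfl⟩ := E.low_or_top g
  · exact h₁ ⟨g, Or.inl h, rfl⟩
  · by_cases hx : IsSourceBdry x
    · exact h₁ ⟨_, Or.inr ⟨x, hx, rfl⟩, rfl⟩
    -- Now `x` is the target of `r`, and also of the position parallel to `r` that `c` contains.
    · obtain ⟨r, rfl⟩ := not_not.1 hx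
      obtain ⟨q, hq, e⟩ := hc r
      have := E.topGen_tgt_mem c hq
      rwa [← show Pos.tgt r = B.pos.tgt q from e.2] at this

/-- Every generator in the support of a cell is related to one in the support of its source. -/
theorem exists_rel (E : Supports L) {X : GlobSet} {A : L.Sph (L.nfree X).base}
    (c : L.NCell (L.nfree X) A)
    {g : L.Gen (L.free X)} (hg : Sum.inl g ∈ c.supp) : ∃ g' ∈ L.supp (L.pr₁ A), E.rel X g g' := by
  induction c generalizing g with
  | var v h =>
    subst h
    rw [E.pr₁_parSph]
    obtain hg | ⟨g, hg | hg, e⟩ := hg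
    · cases hg
    · cases e
      rw [E.pr₁_parSph] at hg
      exact ⟨g, hg, E.rel_refl g⟩
    · cases e
      rw [E.pr₂_parSph] at hg
      exact E.rel_genCell (X.par_src_tgt v) hg
  | coh B hB S hS τ τV h ih =>
    subst h
    rw [E.pr₁_map, E.supp_map, E.full_supp₁ hS]
    -- Fullness of `S` puts all low-dimensional positions in the support of its source, so no
    -- replacement is needed.
    have low {g : L.Gen (L.free X)} {q} (hq : q ∈ E.low B.pos) (hg : g ∈ E.genSupp τ q) :
        ∃ g' ∈ ⋃ g ∈ E.low B.pos ∪ E.topGen '' {x : B.Pos n | x.IsSourceBdry}, E.genSupp τ g,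
          E.rel X g g' := ⟨g, Set.mem_iUnion₂.2 ⟨q, Or.inl hq, hg⟩, E.rel_refl g⟩
    -- A position outside the source boundary is some `tgt r`. The induction hypothesis for `τV r`
    -- moves `g` into the image of the support of `src r`: either a low generator or `src r` itself,
    -- of smaller rank.
    have top : ∀ (k : ℕ) (x : B.Pos n), rank x = k → ∀ g ∈ E.genSupp τ (E.topGen x),
        ∃ g' ∈ ⋃ g ∈ E.low B.pos ∪ E.topGen '' {x : B.Pos n | x.IsSourceBdry}, E.genSupp τ g,
          E.rel X g g' := by
      intro k
      induction k using Nat.strong_induction_on with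
      | _ k ihk =>
        rintro x rfl g hg
        by_cases hx : IsSourceBdry x
        · exact ⟨g, Set.mem_iUnion₂.2 ⟨_, Or.inr ⟨x, hx, rfl⟩, hg⟩, E.rel_refl g⟩
        · obtain ⟨r, rfl⟩ := not_not.1 hx
          have h₂ : Sum.inl g ∈ (τV r).supp := by
            refine E.image_supp_pr₂_subset (τV r) ⟨g, ?_, rfl⟩
            rw [E.pr₂_map, E.pr₂_parSph, E.supp_map]
            exact Set.mem_iUnion₂.2 ⟨_, E.topGen_mem_supp _, hg⟩
          obtain ⟨g', hg', hr⟩ := ih r h₂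
          rw [E.pr₁_map, E.pr₁_parSph, E.supp_map] at hg'
          obtain ⟨q, hq, hg'⟩ := Set.mem_iUnion₂.1 hg'
          obtain hq | rfl := E.supp_genCell _ hq
          · obtain ⟨g'', h, h'⟩ := low hq hg'
            exact ⟨g'', h, E.rel_trans hr h'⟩
          · obtain ⟨g'', h, h'⟩ := ihk _ (rank_src_lt r) _ rfl g' hg'
            exact ⟨g'', h, E.rel_trans hr h'⟩
    have all {g : L.Gen (L.free X)} (hg : g ∈ L.homSupp τ) :
        ∃ g' ∈ ⋃ g ∈ E.low B.pos ∪ E.topGen '' {x : B.Pos n | x.IsSourceBdry}, E.genSupp τ g,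
          E.rel X g g' := by
      rw [E.homSupp_eq] at hg
      obtain ⟨q, hq⟩ := Set.mem_iUnion.1 hg
      obtain h | ⟨x, rfl⟩ := E.low_or_top q
      · exact low h hq
      · exact top _ x rfl g hq
    obtain ⟨g, hg, e⟩ | hg := hg
    · cases e
      exact all hg
    · obtain ⟨p, hp⟩ := Set.mem_iUnion.1 hg
      obtain ⟨g', hg', hr⟩ := ih p hp
      rw [E.pr₁_map, E.supp_map] at hg'
      have hg' : g' ∈ L.homSupp τ := by
        rw [E.homSupp_eq]
        exact Set.iUnion₂_subset (fun g _ => Set.subset_iUnion _ g) hg'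
      obtain ⟨g'', h, h'⟩ := all hg'
      exact ⟨g'', h, E.rel_trans hr h'⟩

/-! Injectivity and lifting along an injective morphism of globular sets. -/

theorem map_freeMap_injective (E : Supports L) {X Y : GlobSet} (f : GlobSet.Hom X Y)
    (hf : ∀ k, Function.Injective (f.app (n := k))) {A : L.Sph (L.nfree X).base}
    (c c' : L.NCell (L.nfree X) A)
    {A' : L.Sph (L.free Y)} (h : L.sphMap (L.freeMap f) A = A')
    (e : c.map (nfreeMap f) h = c'.map (nfreeMap f) h) : c = c' := by
  induction c generalizing A' with
  | var v hv =>
    cases c' with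
    | var v' hv' =>
      obtain rfl : v = v' := hf _ (NCell.var.inj e)
      rfl
    | coh => cases e
  | coh B hB S hS τ τV hS' ih =>
    cases c' with
    | var => cases e
    | coh B₂ hB₂ S₂ hS₂ τ₂ τV₂ hS₂' =>
      obtain ⟨rfl, e₁, e₂, e₃⟩ := NCell.coh.inj e
      obtain rfl := eq_of_heq e₁
      obtain rfl := E.comp_freeMap_injective f hf (eq_of_heq e₂)
      obtain rfl : τV = τV₂ := funext fun p => ih p _ _ (congrFun (eq_of_heq e₃) p)
      rfl

/-- The trees and full spheres of coherence cells do not refer to the ambient computad, so a cell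
lifts as soon as its generators do. Its boundary is lifted along with it. -/
theorem exists_map_freeMap (E : Supports L) {X Y : GlobSet} (f : GlobSet.Hom X Y)
    (hf : ∀ k, Function.Injective (f.app (n := k))) {A : L.Sph (L.nfree Y).base}
    (c : L.NCell (L.nfree Y) A)
    (hc : c.supp ⊆ Set.range (E.nextGenMap f)) :
    ∃ (A' : L.Sph (L.free X)) (h : L.sphMap (L.freeMap f) A' = A) (c' : L.NCell (L.nfree X) A'),
      c'.map (nfreeMap f) h = c := by
  induction c with
  | var y h =>
    subst h
    obtain ⟨g | x, hx⟩ := hc (Or.inl rfl)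
    · cases hx
    · obtain rfl : f.app x = y := Sum.inr.inj hx
      refine ⟨(L.nfree X).φ x, ?_, NCell.var x rfl, rfl⟩
      refine (L.sphMap_parSph _ _ _ _).trans ?_
      simp only [f.app_src, f.app_tgt]
  | coh B hB S hS τ τV h ih =>
    obtain ⟨τ', rfl⟩ := E.exists_comp_freeMap f hf τ fun g hg => by
      obtain ⟨g' | x, h⟩ := hc (Or.inl ⟨g, hg, rfl⟩)
      · exact ⟨g', Sum.inl.inj h⟩
      · cases h
    have hp (p : B.Pos (n + 1)) : ∃ c' : L.NCell (L.nfree X) (L.sphMap τ' ((L.nfree B.pos).φ p)),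
        c'.map (nfreeMap f) (L.sphMap_comp _ _ _).symm = τV p := by
      obtain ⟨A', h', c', e⟩ := ih p fun g hg => hc (Or.inr (Set.mem_iUnion.2 ⟨p, hg⟩))
      -- The boundary found with the lift must agree with the one prescribed by `τ'`; injectivity on
      -- spheres forces this.
      obtain rfl : A' = L.sphMap τ' ((L.nfree B.pos).φ p) :=
        E.sphMap_freeMap_injective f hf (h'.trans (L.sphMap_comp _ _ _))
      exact ⟨c', e⟩
    choose τV' hτV' using hp
    refine ⟨L.sphMap τ' S, (L.sphMap_comp _ _ _).symm.trans h, NCell.coh B hB S hS τ' τV' rfl, ?_⟩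
    exact NCell.coh_congr rfl (fun p => (NCell.retype_rfl _).trans (hτV' p)) _ _

end Supports

end


theorem NCell.gens_map_var {n : ℕ} {L : Level n} {D C : L.NComp} (σ : L.NHom D C) (v : D.V)
    {A : L.Sph D.base} (h : D.φ v = A) {A' : L.Sph C.base} (h' : L.sphMap σ.base A = A') :
    ((NCell.var v h).map σ h').gens = (σ.onV v).gens :=
  NCell.gens_retype _ _

/-- The support of an `(n+1)`-homomorphism. -/
def NHom.supp {n : ℕ} {L : Level n} {D C : L.NComp} (σ : L.NHom D C) :
    Set (L.Gen C.base ⊕ C.V) :=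
  Sum.inl '' L.homSupp σ.base ∪ ⋃ v, (σ.onV v).supp

/-! ### Passage of the whole package from stage n to stage n + 1 -/

namespace Supports

variable {n : ℕ} {L : Level n}

/-- Equality of generators of dimension at most `n`, and parallelism in dimension `n + 1`. -/
def nextRel (L : Level n) (X : GlobSet) :
    L.Gen (L.free X) ⊕ X.cell (n + 1) → L.Gen (L.free X) ⊕ X.cell (n + 1) → Prop
  | Sum.inl g, Sum.inl h => g = h
  | Sum.inr x, Sum.inr y => X.Par x y
  | _, _ => False

theorem nextRel_refl {X : GlobSet} : ∀ g, nextRel L X g g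
  | Sum.inl _ => rfl
  | Sum.inr _ => GlobSet.Par.refl (n := n + 1) X _

theorem nextRel_trans {X : GlobSet} : ∀ {g h k}, nextRel L X g h → nextRel L X h k → nextRel L X g k
  | Sum.inl _, Sum.inl _, Sum.inl _, e, e' => Eq.trans e e'
  | Sum.inr _, Sum.inr _, Sum.inr _, e, e' => GlobSet.Par.trans (X := X) (n := n + 1) e e'

/-- Fullness prescribes the top-dimensional support only. The lower generators follow from
`inl_mem_supp`, as source boundary positions meet every parallel class. -/
theorem full_supp_fst (E : Supports L) {B : Bat} {A : L.NSph (L.nfree B.pos)}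
    (h : L.next.Full B A) :
    A.fst.supp = Set.range Sum.inl ∪ Sum.inr '' {x : B.Pos (n + 1) | x.IsSourceBdry} := by
  obtain ⟨h₁, -, h₂⟩ := h
  ext (g | x)
  · refine iff_of_true ?_ (Or.inl ⟨g, rfl⟩)
    refine E.inl_mem_supp h₂ A.fst (fun p => ?_) g
    rw [h₁]
    obtain ⟨q, hq, hq'⟩ := exists_par_isSourceBdry p
    exact ⟨q, hq', hq⟩
  · rw [NCell.inr_mem_supp, h₁]
    simp

theorem full_supp_snd (E : Supports L) {B : Bat} {A : L.NSph (L.nfree B.pos)}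
    (h : L.next.Full B A) :
    A.snd.supp = Set.range Sum.inl ∪ Sum.inr '' {x : B.Pos (n + 1) | x.IsTargetBdry} := by
  obtain ⟨-, h₁, h₂⟩ := h
  ext (g | x)
  · refine iff_of_true ?_ (Or.inl ⟨g, rfl⟩)
    refine E.inl_mem_supp h₂ A.snd (fun p => ?_) g
    rw [h₁]
    obtain ⟨q, hq, hq'⟩ := exists_par_isTargetBdry p
    exact ⟨q, hq', hq⟩
  · rw [NCell.inr_mem_supp, h₁]
    simp

theorem full_of_gens_next (E : Supports L) {B : Bat} {A : L.NSph (L.nfree B.pos)}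
    (m : Multiset (B.Pos (n + 2)))
    (h : A.fst.gens + m.map Pos.tgt = A.snd.gens + m.map Pos.src)
    (hm : ∀ p, ∃ q ∈ m, B.pos.Par p q)
    (hA : ∀ g, ∃ g' ∈ A.fst.supp, nextRel L B.pos g g') : L.next.Full B A := by
  classical
  have hbd : L.Full B A.bd := by
    -- The generators of `A.fst` take the role of `m` one dimension lower; `hA` supplies the classes
    -- they meet, and `exists_rel` passes the condition on to the source of `A.fst`.
    refine E.full_of_gens A.fst.gens (E.stokes A.fst) (fun p => ?_) fun g => ?_
    · obtain ⟨g | q, hq, hr⟩ := hA (Sum.inr p)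
      · exact hr.elim
      · exact ⟨q, (NCell.mem_gens _ _).2 ((NCell.inr_mem_supp _ _).1 hq), hr⟩
    · obtain ⟨g' | q, hg', hr⟩ := hA (Sum.inl g)
      · obtain rfl : g = g' := hr
        exact E.exists_rel A.fst hg'
      · exact hr.elim
  -- Since the common boundary is full, both cells contain each class exactly once.
  obtain ⟨h₁, h₂⟩ := mem_iff_bdry (E.countP_gens hbd A.fst) (E.countP_gens hbd A.snd)
    (fun p => Multiset.countP_pos.2 (hm p)) h
  refine ⟨Set.ext fun x => ?_, Set.ext fun x => ?_, hbd⟩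
  · exact (NCell.mem_gens _ _).symm.trans (h₁ x)
  · exact (NCell.mem_gens _ _).symm.trans (h₂ x)

theorem sphMap_freeMap_injective_next (E : Supports L) {X Y : GlobSet} (f : GlobSet.Hom X Y)
    (hf : ∀ k, Function.Injective (f.app (n := k))) :
    Function.Injective (NSph.map (L := L) (nfreeMap f)) := by
  rintro ⟨A, a, b⟩ ⟨A', a', b'⟩ h
  obtain ⟨h₀, h₁, h₂⟩ := NSph.mk.inj h
  obtain rfl := E.sphMap_freeMap_injective f hf h₀
  obtain rfl := E.map_freeMap_injective f hf _ _ _ (eq_of_heq h₁)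
  obtain rfl := E.map_freeMap_injective f hf _ _ _ (eq_of_heq h₂)
  rfl

theorem comp_freeMap_injective_next (E : Supports L) {X Y : GlobSet} (f : GlobSet.Hom X Y)
    (hf : ∀ k, Function.Injective (f.app (n := k))) {D : L.NComp} {τ τ' : L.NHom D (L.nfree X)}
    (h : (nfreeMap f).comp τ = (nfreeMap f).comp τ') : τ = τ' := by
  obtain ⟨τ, τV⟩ := τ
  obtain ⟨τ', τV'⟩ := τ'
  obtain ⟨h₀, h₁⟩ := NHom.mk.inj h
  obtain rfl := E.comp_freeMap_injective f hf h₀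
  obtain rfl : τV = τV' := funext fun v =>
    E.map_freeMap_injective f hf _ _ _ (congrFun (eq_of_heq h₁) v)
  rfl

theorem exists_comp_freeMap_next (E : Supports L) {X Y : GlobSet} (f : GlobSet.Hom X Y)
    (hf : ∀ k, Function.Injective (f.app (n := k))) {D : L.NComp} (τ : L.NHom D (L.nfree Y))
    (h : NHom.supp τ ⊆ Set.range (E.nextGenMap f)) :
    ∃ τ', (nfreeMap f).comp τ' = τ := by
  obtain ⟨τ, τV⟩ := τ
  obtain ⟨τ', rfl⟩ := E.exists_comp_freeMap f hf τ fun g hg => by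
    obtain ⟨g' | x, h⟩ := h (Or.inl ⟨g, hg, rfl⟩)
    · exact ⟨g', Sum.inl.inj h⟩
    · cases h
  have hv (v : D.V) : ∃ c' : L.NCell (L.nfree X) (L.sphMap τ' (D.φ v)),
      c'.map (nfreeMap f) (L.sphMap_comp _ _ _).symm = τV v := by
    obtain ⟨A', h', c', e⟩ := E.exists_map_freeMap f hf (τV v)
      fun g hg => h (Or.inr (Set.mem_iUnion.2 ⟨v, hg⟩))
    obtain rfl : A' = L.sphMap τ' (D.φ v) :=
      E.sphMap_freeMap_injective f hf (h'.trans (L.sphMap_comp _ _ _))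
    exact ⟨c', e⟩
  choose τV' hτV' using hv
  exact ⟨⟨τ', τV'⟩, NHom.ext rfl fun v => (NCell.retype_rfl _).trans (hτV' v)⟩

theorem homSupp_comp_next (E : Supports L) {F D C : L.NComp} (σ : L.NHom D C) (τ : L.NHom F D) :
    NHom.supp (σ.comp τ) = ⋃ g ∈ NHom.supp τ, E.nextGenSupp σ g := by
  rw [NHom.supp, NHom.supp, Set.biUnion_union, E.homSupp_comp, Set.biUnion_image, Set.image_iUnion₂,
    Set.biUnion_iUnion]
  exact congrArg₂ _ rfl (Set.iUnion_congr fun v => E.supp_map_next _ _ _)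

theorem homSupp_comp_freeMap_next (E : Supports L) {X Y : GlobSet} (f : GlobSet.Hom X Y)
    {D : L.NComp} (τ : L.NHom D (L.nfree X)) :
    NHom.supp ((nfreeMap f).comp τ) = E.nextGenMap f '' NHom.supp τ := by
  rw [NHom.supp, NHom.supp, Set.image_union, E.homSupp_comp_freeMap, Set.image_iUnion, Set.image_image,
    Set.image_image]
  exact congrArg₂ _ rfl (Set.iUnion_congr fun v => E.supp_freeMap_next _ _ _)

theorem homSupp_id_next (E : Supports L) (C : L.NComp) :
    NHom.supp (NHom.id C) = Set.univ := by
  refine Set.eq_univ_of_forall fun g => ?_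
  obtain g | v := g
  · refine Or.inl ⟨g, ?_, rfl⟩
    rw [E.homSupp_id]
    trivial
  · exact Or.inr (Set.mem_iUnion.2 ⟨v, Or.inl rfl⟩)

theorem homSupp_eq_next (E : Supports L) {D C : L.NComp} (σ : L.NHom D C) :
    NHom.supp σ = ⋃ g, E.nextGenSupp σ g := by
  rw [Set.iUnion_sum, NHom.supp, E.homSupp_eq, Set.image_iUnion]
  rfl

theorem rel_genCell_next {X : GlobSet} {x y : X.cell (n + 1)}
    {g : L.Gen (L.free X) ⊕ X.cell (n + 1)} (h : X.Par x y)
    (hg : g ∈ (NCell.var (C := L.nfree X) y rfl).supp) :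
    ∃ g' ∈ (NCell.var (C := L.nfree X) x rfl).supp, nextRel L X g g' := by
  obtain rfl | hg := hg
  · exact ⟨_, Or.inl rfl, h.symm⟩
  · refine ⟨g, Or.inr ?_, nextRel_refl g⟩
    have hφ : (L.nfree X).φ y = (L.nfree X).φ x := by simp only [nfree, h.1, h.2]
    rwa [hφ] at hg

/-- The data at stage `n + 1`. -/
noncomputable def next (E : Supports L) : Supports L.next where
  genSupp σ := E.nextGenSupp σ
  genMap f := E.nextGenMap f
  topGen x := Sum.inr x
  low _ := Set.range Sum.inl
  rel X := nextRel L X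
  gens c := c.2.gens
  pr₁_map _ _ := rfl
  pr₂_map _ _ := rfl
  pr₁_parSph _ _ _ _ := rfl
  pr₂_parSph X x y h := by
    have hφ : (L.nfree X).φ y = (L.nfree X).φ x := by simp only [nfree, h.1, h.2]
    exact Sigma.ext hφ.symm (by
      change HEq (NCell.var (C := L.nfree X) y hφ) (NCell.var (C := L.nfree X) y rfl)
      congr 1
      · exact hφ.symm
      · exact proof_irrel_heq _ _)
  homSupp_eq := E.homSupp_eq_next
  homSupp_id := E.homSupp_id_next
  homSupp_comp := E.homSupp_comp_next
  supp_map σ c := E.supp_map_next σ c.2 rfl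
  homSupp_comp_freeMap f _ τ := E.homSupp_comp_freeMap_next f τ
  supp_freeMap f c := E.supp_freeMap_next f c.2 rfl
  genMap_injective f hf := Sum.map_injective.2 ⟨E.genMap_injective f hf, hf _⟩
  genMap_surjective f hf := Sum.map_surjective.2
    ⟨E.genMap_surjective f fun k hk => hf k (Nat.le_succ_of_le hk), hf _ le_rfl⟩
  genMap_topGen _ _ := rfl
  mem_low_genMap f hf := by
    have := E.genMap_surjective f fun k hk => hf k (Nat.lt_succ_of_le hk)
    refine (Set.range_comp _ _).symm.trans ?_
    exact this.range_comp (Sum.inl : _ → L.Gen (L.free _) ⊕ _)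
  low_or_top g := by
    obtain g | x := g
    · exact Or.inl ⟨g, rfl⟩
    · exact Or.inr ⟨x, rfl⟩
  topGen_mem_supp _ := Or.inl rfl
  supp_genCell x g hg := by
    obtain hg | ⟨g, -, hg⟩ := hg
    · exact Or.inr hg
    · exact Or.inl ⟨g, hg⟩
  rel_refl := nextRel_refl
  rel_trans := nextRel_trans
  rel_genCell := rel_genCell_next
  full_supp₁ := E.full_supp_fst
  full_supp₂ := E.full_supp_snd
  gens_genCell _ := rfl
  gens_map τ c := (NCell.gens_map τ c.2 rfl).trans
    (Multiset.bind_congr fun x _ => (NCell.gens_map_var τ x rfl rfl).symm)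
  full_gens₁ {B A} h := eq_sourceBdry (E.countP_gens h.2.2 A.fst) fun x =>
    (NCell.mem_gens _ _).trans (Set.ext_iff.1 h.1 x)
  full_gens₂ {B A} h := eq_targetBdry (E.countP_gens h.2.2 A.snd) fun x =>
    (NCell.mem_gens _ _).trans (Set.ext_iff.1 h.2.1 x)
  full_of_gens := E.full_of_gens_next
  sphMap_freeMap_injective := E.sphMap_freeMap_injective_next
  comp_freeMap_injective := E.comp_freeMap_injective_next
  exists_comp_freeMap f hf _ := E.exists_comp_freeMap_next f hf
  exists_cellMap_freeMap f hf c h := by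
    obtain ⟨A', h', c', e⟩ := E.exists_map_freeMap f hf c.2 h
    obtain ⟨A, c⟩ := c
    obtain rfl : _ = A := h'
    exact ⟨⟨A', c'⟩, congrArg (Sigma.mk _) e⟩

end Supports

end Level

/-- The data at stage `n`. -/
noncomputable def supports : ∀ n : ℕ, (level n).Supports
  | 0 => Level.Supports.base
  | n + 1 => (supports n).next


open Bat Bat.Pos

/-! ### Cells as homomorphisms out of globes -/

/-- The cells `x` and `y` form a globular sphere: they are distinct and the only cells of their
dimension, and so are recursively their source and target. -/
def IsGlobularSphere (X : GlobSet) : ∀ {n : ℕ}, X.cell n → X.cell n → Prop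
  | 0, x, y => x ≠ y ∧ ∀ z, z = x ∨ z = y
  | _ + 1, x, y => x ≠ y ∧ (∀ z, z = x ∨ z = y) ∧ IsGlobularSphere X (X.src x) (X.tgt x)

theorem isGlobularSphere_inl : ∀ {m n : ℕ} {x y : Pos (globe m) n},
    IsGlobularSphere (globe m).pos x y →
    IsGlobularSphere (globe (m + 1)).pos (inl x : Pos (globe (m + 1)) (n + 1)) (inl y)
  | m, 0, x, y, h => by
      refine ⟨fun e => h.1 (inl.inj e), fun z => ?_, ⟨fun e => (nomatch e), fun z => ?_⟩⟩
      · cases z with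
        | inl z => exact (h.2 z).imp (congrArg inl) (congrArg inl)
        | inr z => exact (elim_nil_succ z).elim
      · cases z with
        | here => exact Or.inl rfl
        | inr z => cases z; exact Or.inr rfl
  | m, n + 1, x, y, h => by
      refine ⟨fun e => h.1 (inl.inj e), fun z => ?_, isGlobularSphere_inl h.2.2⟩
      cases z with
      | inl z => exact (h.2.1 z).imp (congrArg inl) (congrArg inl)
      | inr z => exact (elim_nil_succ z).elim

theorem isGlobularSphere_globeTop : ∀ n : ℕ,
    IsGlobularSphere (globe (n + 1)).pos (Pos.src (globeTop (n + 1))) (Pos.tgt (globeTop (n + 1)))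
  | 0 => ⟨fun e => (nomatch e), fun z => by
      cases z with
      | here => exact Or.inl rfl
      | inr z => cases z; exact Or.inr rfl⟩
  | n + 1 => isGlobularSphere_inl (isGlobularSphere_globeTop n)

theorem eq_globeTop : ∀ {n : ℕ} (x : Pos (globe n) n), x = globeTop n
  | 0, here _ => rfl
  | _ + 1, inl x => congrArg inl (eq_globeTop x)

namespace Level

variable {n : ℕ} {L : Level n}

/-- As `x` and `y` are parallel, `s` sends their boundary to that of `A`, leaving their images free
to be the two cells of `A`. -/
theorem exists_nextHom {X : GlobSet} {C : L.NComp} (s : L.Hom (L.free X) C.base)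
    {x y : X.cell (n + 1)} (hne : x ≠ y) (hxy : ∀ z, z = x ∨ z = y) (h : X.Par x y)
    (A : L.NSph C) (hs : L.sphMap s ((L.nfree X).φ x) = A.bd) :
    ∃ σ : L.NHom (L.nfree X) C, NSph.map σ (L.next.parSph X x y h) = A := by
  classical
  have hφ : (L.nfree X).φ y = (L.nfree X).φ x := by simp only [nfree, h.1, h.2]
  obtain ⟨bd, a, b⟩ := A
  obtain rfl : _ = bd := hs
  refine ⟨⟨s, fun v => if hv : v = x then a.retype (by rw [hv]) else
    b.retype (by rw [(hxy v).resolve_left hv, hφ])⟩, NSph.ext rfl ?_ ?_⟩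
  · refine (NCell.retype_rfl _).trans ?_
    simp only [next, NCell.map, dif_pos, NCell.retype_rfl]
  · refine (NCell.retype_rfl _).trans ?_
    simp only [next, NCell.map, dif_neg hne.symm, NCell.retype_retype, NCell.retype_rfl]

theorem exists_nextHom_cell {X : GlobSet} {C : L.NComp} (s : L.Hom (L.free X) C.base)
    {x : X.cell (n + 1)} (hx : ∀ z, z = x) (c : L.next.Cell C)
    (hs : L.sphMap s ((L.nfree X).φ x) = c.1) :
    ∃ σ : L.NHom (L.nfree X) C, L.next.cellMap σ (L.next.genCell x) = c := by
  obtain ⟨A, c⟩ := c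
  obtain rfl : _ = A := hs
  refine ⟨⟨s, fun v => c.retype (by rw [hx v])⟩, congrArg (Sigma.mk _) ?_⟩
  simp only [next, NCell.map, NCell.retype_rfl]

theorem NCell.supp_map_var {D C : L.NComp} (σ : L.NHom D C) (v : D.V)
    {A : L.Sph D.base} (h : D.φ v = A) {A' : L.Sph C.base} (h' : L.sphMap σ.base A = A') :
    ((NCell.var v h).map σ h').supp = (σ.onV v).supp :=
  NCell.supp_retype _ _

theorem Supports.image_supp_union_subset (E : Supports L) {X : GlobSet} {C : L.NComp}
    (σ : L.NHom (L.nfree X) C) (x : X.cell (n + 1)) :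
    Sum.inl '' (L.supp (L.cellMap σ.base (L.genCell (X.src x))) ∪
      L.supp (L.cellMap σ.base (L.genCell (X.tgt x)))) ⊆ (σ.onV x).supp := by
  have h₁ := E.image_supp_pr₁_subset (σ.onV x)
  have h₂ := E.image_supp_pr₂_subset (σ.onV x)
  rw [E.pr₁_map, E.pr₁_parSph] at h₁
  rw [E.pr₂_map, E.pr₂_parSph] at h₂
  rw [Set.image_union]
  exact Set.union_subset h₁ h₂

end Level

/-- A globular sphere carries the universal sphere: extend dimension by dimension, choosing images
for the two new cells each time. -/
theorem exists_sphMap_parSph : ∀ {n : ℕ} {X : GlobSet} {x y : X.cell n} (h : X.Par x y),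
    IsGlobularSphere X x y → ∀ {C : Comp n} (A : Sph C),
    ∃ σ : Hom (free n X) C, (level n).sphMap σ ((level n).parSph X x y h) = A
  | 0, X, x, y, _, hX, C, A => by
      classical
      let σ (z : X.cell 0) : C := if z = x then A.1 else A.2
      exact ⟨σ, Prod.ext (if_pos rfl) (if_neg hX.1.symm)⟩
  | _ + 1, X, x, _, h, hX, _, A => by
      obtain ⟨s, hs⟩ := exists_sphMap_parSph (X.par_src_tgt x) hX.2.2 A.bd
      exact Level.exists_nextHom s hX.1 hX.2.1 h A hs

theorem exists_cellMap_globeTop : ∀ {n : ℕ} {C : Comp n} (c : Cell C),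
    ∃ σ : Hom (free n (globe n).pos) C,
      cellMap σ ((level n).genCell (X := (globe n).pos) (globeTop n)) = c
  | 0, C, c => by
      let σ (_ : Pos (globe 0) 0) : C := c
      exact ⟨σ, rfl⟩
  | n + 1, _, c => by
      obtain ⟨s, hs⟩ := exists_sphMap_parSph (par_src_tgt _) (isGlobularSphere_globeTop n)
        (Sigma.fst c)
      exact Level.exists_nextHom_cell s eq_globeTop c hs

theorem supp_cellMap_subset {n : ℕ} {D C : Comp n} (σ : Hom D C) (c : Cell D) :
    (level n).supp (cellMap σ c) ⊆ (level n).homSupp σ := by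
  rw [(supports n).supp_map, (supports n).homSupp_eq]
  exact Set.iUnion₂_subset fun g _ => Set.subset_iUnion _ g

/-- Lower generators come, inductively, from the source and target of `x`, whose images have support
inside that of the image of `x`. -/
theorem homSupp_subset_of_isGlobularSphere : ∀ {n : ℕ} {X : GlobSet} {x y : X.cell n},
    IsGlobularSphere X x y → ∀ {C : Comp n} (σ : Hom (free n X) C),
    (level n).homSupp σ ⊆ (level n).supp (cellMap σ ((level n).genCell x)) ∪
      (level n).supp (cellMap σ ((level n).genCell y))
  | 0, X, x, y, hX, C, σ => by
      rintro g hg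
      obtain ⟨z, hz⟩ := Set.mem_iUnion.1 hg
      obtain rfl | rfl := hX.2 z
      · exact Or.inl hz
      · exact Or.inr hz
  | n + 1, X, x, y, hX, C, σ => by
      have hsupp (v : X.cell (n + 1)) : (level (n + 1)).supp (cellMap σ ((level (n + 1)).genCell v)) =
          (Level.NHom.onV σ v).supp := Level.NCell.supp_map_var σ v rfl rfl
      rw [hsupp, hsupp]
      have ih := homSupp_subset_of_isGlobularSphere hX.2.2 (Level.NHom.base σ)
      have h := (supports n).image_supp_union_subset σ x
      rintro g (⟨g, hg, rfl⟩ | hg)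
      · exact Or.inl (h ⟨g, ih hg, rfl⟩)
      · obtain ⟨z, hz⟩ := Set.mem_iUnion.1 hg
        obtain rfl | rfl := hX.2.1 z
        · exact Or.inl hz
        · exact Or.inr hz

theorem homSupp_globe : ∀ {n : ℕ} {C : Comp n} (σ : Hom (free n (globe n).pos) C),
    (level n).homSupp σ =
      (level n).supp (cellMap σ ((level n).genCell (X := (globe n).pos) (globeTop n)))
  | 0, C, σ => by
      refine subset_antisymm ?_ (supp_cellMap_subset _ _)
      rintro g hg
      obtain ⟨z, hz⟩ := Set.mem_iUnion.1 hg
      obtain rfl := eq_globeTop z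
      exact hz
  | n + 1, C, σ => by
      refine subset_antisymm ?_ (supp_cellMap_subset _ _)
      have hsupp : (level (n + 1)).supp (cellMap σ ((level (n + 1)).genCell
          (X := (globe (n + 1)).pos) (globeTop (n + 1)))) =
          (Level.NHom.onV σ (globeTop (n + 1))).supp :=
        Level.NCell.supp_map_var σ (globeTop (n + 1)) rfl rfl
      rw [hsupp]
      have ih := homSupp_subset_of_isGlobularSphere (isGlobularSphere_globeTop n)
        (Level.NHom.base σ)
      have h := (supports n).image_supp_union_subset σ (globeTop (n + 1))
      rintro g (⟨g, hg, rfl⟩ | hg)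
      · exact h ⟨g, ih hg, rfl⟩
      · obtain ⟨z, hz⟩ := Set.mem_iUnion.1 hg
        obtain rfl := eq_globeTop z
        exact hz

/-- Eliminates globes: every cell is the value at the top of some homomorphism from the globe, and
the support of such a homomorphism is that of the value, since supports of cells contain those of
their boundaries. -/
theorem covers_iff {n : ℕ} {C : Comp n} (c : Cell C) : Covers c ↔ (level n).supp c = Set.univ := by
  refine ⟨?_, fun h => ?_⟩
  · rintro ⟨σ, rfl, hσ⟩
    exact (homSupp_globe σ).symm.trans hσ
  · obtain ⟨σ, rfl⟩ := exists_cellMap_globeTop c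
    exact ⟨σ, rfl, (homSupp_globe σ).trans h⟩

/-! ### Full spheres -/

theorem full_ty_of_covers {n : ℕ} {B : Bat} {c : Cell (free (n + 1) B.pos)} (h : Covers c) :
    Full B (ty c) := by
  have h := Set.eq_univ_iff_forall.1 ((covers_iff c).1 h)
  refine (supports n).full_of_gens (Level.NCell.gens c.2) ((supports n).stokes c.2)
    (fun p => ⟨p, ?_, GlobSet.Par.refl _ _⟩) fun g => (supports n).exists_rel c.2 (h (Sum.inl g))
  exact (Level.NCell.mem_gens _ _).2 ((Level.NCell.inr_mem_supp _ _).1 (h (Sum.inr p)))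

theorem exists_covers_of_full {n : ℕ} {B : Bat} (hB : B.dim ≤ n + 1) {A : Sph (free n B.pos)}
    (hA : Full B A) : ∃ c : Cell (free (n + 1) B.pos), ty c = A ∧ Covers c := by
  refine ⟨⟨A, Level.NCell.coh B hB A hA ((level n).id _)
    (fun p => Level.NCell.var p ((level n).sphMap_id _).symm) ((level n).sphMap_id A)⟩, rfl, ?_⟩
  refine (covers_iff _).2 (Set.eq_univ_of_forall fun g => ?_)
  obtain g | p := g
  · exact Or.inl ⟨g, Set.eq_univ_iff_forall.1 ((supports n).homSupp_id _) g, rfl⟩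
  · exact Or.inr (Set.mem_iUnion.2 ⟨p, Or.inl rfl⟩)

theorem range_genMap {n : ℕ} {X Y : GlobSet} (f : GlobSet.Hom X Y)
    (hf : ∀ k < n, Function.Surjective (f.app (n := k))) :
    Set.range ((supports n).genMap f) =
      (supports n).low Y ∪ (supports n).topGen '' Set.range (f.app (n := n)) := by
  rw [← (supports n).mem_low_genMap f hf]
  ext g
  constructor
  · rintro ⟨g, rfl⟩
    obtain h | ⟨x, rfl⟩ := (supports n).low_or_top g
    · exact Or.inl ⟨g, h, rfl⟩
    · exact Or.inr ⟨_, ⟨x, rfl⟩, ((supports n).genMap_topGen f x).symm⟩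
  · rintro (⟨g, -, rfl⟩ | ⟨_, ⟨x, rfl⟩, rfl⟩)
    · exact ⟨g, rfl⟩
    · exact ⟨_, (supports n).genMap_topGen f x⟩

theorem range_genMap_srcIncl (n : ℕ) (B : Bat) :
    Set.range ((supports n).genMap (srcIncl n B)) =
      (supports n).low B.pos ∪ (supports n).topGen '' {x : B.Pos n | x.IsSourceBdry} := by
  rw [range_genMap _ fun k hk => sIncl_surjective n B hk]
  exact congrArg₂ _ rfl (congrArg _ (Set.ext fun x => mem_range_sIncl))

theorem range_genMap_tgtIncl (n : ℕ) (B : Bat) :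
    Set.range ((supports n).genMap (tgtIncl n B)) =
      (supports n).low B.pos ∪ (supports n).topGen '' {x : B.Pos n | x.IsTargetBdry} := by
  rw [range_genMap _ fun k hk => tIncl_surjective n B hk]
  exact congrArg₂ _ rfl (congrArg _ (Set.ext fun x => mem_range_tIncl))

/-- The lift covers because its support and the set of all generators have the same image under an
injective map. -/
theorem exists_covers_cellMap {n : ℕ} {X Y : GlobSet} (f : GlobSet.Hom X Y)
    (hf : ∀ k, Function.Injective (f.app (n := k))) {c : Cell (free n Y)}
    (hc : (level n).supp c = Set.range ((supports n).genMap f)) :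
    ∃ a : Cell (free n X), Covers a ∧ c = cellMap (freeMap n f) a := by
  obtain ⟨a, rfl⟩ := (supports n).exists_cellMap_freeMap f hf c hc.subset
  refine ⟨a, (covers_iff a).2 ?_, rfl⟩
  rw [(supports n).supp_freeMap, ← Set.image_univ] at hc
  exact ((supports n).genMap_injective f hf).image_injective hc

theorem topSupp_map_freeMap {n : ℕ} {X Y : GlobSet} (f : GlobSet.Hom X Y)
    {A : (level n).Sph ((level n).nfree X).base} (c : (level n).NCell ((level n).nfree X) A)
    {A' : (level n).Sph ((level n).free Y)} (h : (level n).sphMap ((level n).freeMap f) A = A') :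
    (c.map (Level.nfreeMap f) h).topSupp = f.app '' c.topSupp := by
  ext y
  rw [← Level.NCell.inr_mem_supp, (supports n).supp_freeMap_next]
  constructor
  · rintro ⟨g | x, hx, e⟩
    · cases e
    · exact ⟨x, (Level.NCell.inr_mem_supp _ _).1 hx, Sum.inr.inj e⟩
  · rintro ⟨x, hx, rfl⟩
    exact ⟨Sum.inr x, (Level.NCell.inr_mem_supp _ _).2 hx, rfl⟩

theorem image_sIncl_sourceBdry {k n : ℕ} (h : n < k) (B : Bat) :
    sIncl k B '' {x : Pos (bdry k B) n | x.IsSourceBdry} = {x : Pos B n | x.IsSourceBdry} := by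
  ext x
  obtain ⟨y, rfl⟩ := sIncl_surjective k B h x
  exact (sIncl_injective k B).mem_set_image.trans (isSourceBdry_sIncl h y).symm

theorem image_sIncl_targetBdry {k n : ℕ} (h : n < k) (B : Bat) :
    sIncl k B '' {x : Pos (bdry k B) n | x.IsTargetBdry} = {x : Pos B n | x.IsTargetBdry} := by
  ext x
  obtain ⟨y, rfl⟩ := sIncl_surjective k B h x
  exact (sIncl_injective k B).mem_set_image.trans (isTargetBdry_sIncl h y).symm

/-- Strictly below dimension `k` the inclusion is bijective and matches both kinds of boundary
positions; in dimension `k` itself its image would be source boundary only. -/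
theorem full_sphMap_srcIncl : ∀ {n k : ℕ} (_ : n < k) {B : Bat} {A : Sph (free n (bdry k B).pos)},
    Full (bdry k B) A → Full B ((level n).sphMap (freeMap n (srcIncl k B)) A)
  | 0, _, h, _, A, hA =>
      ⟨(isSourceBdry_sIncl h _).2 hA.1, (isTargetBdry_sIncl h _).2 hA.2⟩
  | n + 1, k, h, B, A, hA => by
      refine ⟨?_, ?_, full_sphMap_srcIncl (Nat.lt_of_succ_lt h) hA.2.2⟩
      · refine (topSupp_map_freeMap (srcIncl k B) _ _).trans ?_
        rw [hA.1]
        exact image_sIncl_sourceBdry h B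
      · refine (topSupp_map_freeMap (srcIncl k B) _ _).trans ?_
        rw [hA.2.1]
        exact image_sIncl_targetBdry h B

theorem full_of_supp : ∀ {n : ℕ} {B : Bat} {A : Sph (free n B.pos)}
    {a : Cell (free n (bdry n B).pos)} {b : Cell (free n (bdry n B).pos)}, Covers a → Covers b →
    pr₁ A = cellMap (freeMap n (srcIncl n B)) a → pr₂ A = cellMap (freeMap n (tgtIncl n B)) b →
    Full B A
  | 0, B, A, a, b, _, _, h₁, h₂ => by
      refine ⟨?_, ?_⟩
      · exact mem_range_sIncl.1 ⟨a, h₁.symm⟩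
      · exact mem_range_tIncl.1 ⟨b, h₂.symm⟩
  | n + 1, B, A, a, b, ha, hb, h₁, h₂ => by
      have hfst := (congrArg (level (n + 1)).supp h₁).trans
        ((supports (n + 1)).supp_freeMap (srcIncl (n + 1) B) a)
      have hsnd := (congrArg (level (n + 1)).supp h₂).trans
        ((supports (n + 1)).supp_freeMap (tgtIncl (n + 1) B) b)
      rw [(covers_iff a).1 ha, Set.image_univ, range_genMap_srcIncl] at hfst
      rw [(covers_iff b).1 hb, Set.image_univ, range_genMap_tgtIncl] at hsnd
      refine ⟨Set.ext fun x => ?_, Set.ext fun x => ?_, ?_⟩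
      · refine (Level.NCell.inr_mem_supp _ _).symm.trans ((Set.ext_iff.1 hfst (Sum.inr x)).trans ?_)
        exact ⟨fun h => by
          obtain ⟨_, h⟩ | ⟨_, h, e⟩ := h
          · cases h
          · cases e; exact h, fun h => Or.inr ⟨x, h, rfl⟩⟩
      · refine (Level.NCell.inr_mem_supp _ _).symm.trans ((Set.ext_iff.1 hsnd (Sum.inr x)).trans ?_)
        exact ⟨fun h => by
          obtain ⟨_, h⟩ | ⟨_, h, e⟩ := h
          · cases h
          · cases e; exact h, fun h => Or.inr ⟨x, h, rfl⟩⟩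
      -- The common boundary can be read from the source side alone: it is the image under `s` of
      -- the boundary of `a`, which is full because `a` covers.
      · have hbd : A.bd = _ := congrArg Sigma.fst h₁
        rw [hbd]
        exact full_sphMap_srcIncl (Nat.lt_succ_self n) (full_ty_of_covers ha)

end WeakOmega

open WeakOmega in
theorem mainTheorem11 (B : Bat) (n : ℕ) (A : Sph (free n B.pos)) :
    (Full B A ↔
      ∃ a b : Cell (free n (Bat.bdry n B).pos), Covers a ∧ Covers b ∧
        pr₁ A = cellMap (freeMap n (Bat.srcIncl n B)) a ∧
        pr₂ A = cellMap (freeMap n (Bat.tgtIncl n B)) b) ∧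
    (B.dim ≤ n + 1 →
      (Full B A ↔ ∃ c : Cell (free (n + 1) B.pos), ty c = A ∧ Covers c)) := by
  refine ⟨⟨fun hA => ?_, ?_⟩, fun hB => ⟨exists_covers_of_full hB, ?_⟩⟩
  · obtain ⟨a, ha, ha'⟩ := exists_covers_cellMap (Bat.srcIncl n B)
      (fun _ => Bat.sIncl_injective n B)
      (((supports n).full_supp₁ hA).trans (range_genMap_srcIncl n B).symm)
    obtain ⟨b, hb, hb'⟩ := exists_covers_cellMap (Bat.tgtIncl n B)
      (fun _ => Bat.tIncl_injective n B)
      (((supports n).full_supp₂ hA).trans (range_genMap_tgtIncl n B).symm)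
    exact ⟨a, b, ha, hb, ha', hb'⟩
  · rintro ⟨a, b, ha, hb, h₁, h₂⟩
    exact full_of_supp ha hb h₁ h₂
  · rintro ⟨c, rfl, hc⟩
    exact full_ty_of_covers hc
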